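/- **Setting.** A composite beam of length $1$ and width $2g_b>0$ consists of a substrate layer $-h_1\le z_3\le h_1$ (index $s$) and a perfectly bonded piezoelectric layer $h_1\le z_3\le h_2$ (index $p$), $0<h_1<h_2$, with mass densities $\rho^k>0$, stiffnesses $C^k>0$, shear moduli $G^k>0$ ($k\in\{s,p\}$), permittivity $\varepsilon>0$, magnetic permeability $\mu>0$ and piezoelectric coupling coefficient $\gamma\ne 0$. Put $$A^p=2g_b(h_2-h_1),\quad A^s=4g_bh_1,\quad I^p=\tfrac23 g_b(h_2^3-h_1^3),\quad I^s=\tfrac43 g_bh_1^3,\quad I_0=g_b(h_2^2-h_1^2),$$ $$\rho_A=\rho^pA^p+\rho^sA^s,\quad \rho_I=\rho^pI^p+\rho^sI^s,\quad \rho_{I_0}=\rho^pI_0,$$ $$C_A=C^pA^p+C^sA^s,\quad C_I=C^pI^p+C^sI^s,\quad C_{I_0}=C^pI_0,\quad G_A=G^sA^s+G^pA^p .$$ With longitudinal displacement $v$, transverse displacement $w$, rotation $\phi$, magnetic flux $\Phi$ and distributed current $\mathcal I$, the Timoshenko model on $z\in(0,1)$ is $$\begin{aligned} \rho_A\ddot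 v-\rho_{I_0}\ddot\phi&=C_Av_{zz}-C_{I_0}\phi_{zz}-\gamma A^p\dot\Phi_z,\\ \rho_I\ddot\phi-\rho_{I_0}\ddot v&=C_I\phi_{zz}-C_{I_0}v_{zz}+\gamma I_0\dot\Phi_z+\tfrac12G_A(w_z-\phi),\\ \rho_A\ddot w&=\tfrac12G_A(w_{zz}-\phi_z),\\ \varepsilon A^p\ddot\Phi&=\tfrac1\mu A^p\Phi_{zz}-\gamma(A^p\dot v_z-I_0\dot\phi_z)-(h_2-h_1)\mathcal I, \end{aligned}$$ with $v=\phi=w=\Phi=0$ (and likewise for the velocities) at $z=0$, and at $z=1$ $$C_Av_z-C_{I_0}\phi_z-\gamma A^p\dot\Phi=0,\quad C_I\phi_z-C_{I_0}v_z+\gamma I_0\dot\Phi=0,\quad w_z-\phi=0,\quad \Phi_z=0 .$$ The loop is closed by the feedback $\mathcal I=\frac{\kappa}{h_2-h_1}\dot\Phi$ with $\kappa>0$. Let $\theta=w_z-\phi$. The state is $$x=\big(v_z,\ \phi_z,\ \theta,\ \Phi_z,\ \rho_A\dot v-\rho_{I_0}\dot\phi,\ \rho_I\dot\phi-\rho_{I_0}\dot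 v,\ \rho_A\dot w,\ \varepsilon A^p\dot\Phi+\gamma(A^pv_z-I_0\phi_z)\big)\in L^2(0,1)^8 ,$$ and $v_z,\phi_z,\theta,\Phi_z,\dot v,\dot\phi,\dot w,\dot\Phi$ are regarded as linear functions of $x$. The energy is $$\mathcal H_T(x)=\tfrac12\int_0^1\Big[\rho_A\dot v^2+\rho_I\dot\phi^2-2\rho_{I_0}\dot v\dot\phi+\rho_A\dot w^2+\varepsilon A^p\dot\Phi^2+C_Av_z^2+C_I\phi_z^2-2C_{I_0}v_z\phi_z+\tfrac12G_A\theta^2+\tfrac1\mu A^p\Phi_z^2\Big]dz ,$$ and $\|x\|_{\mathcal H}=\sqrt{2\mathcal H_T(x)}$. The closed-loop operator is $$\mathcal A_2x=\begin{pmatrix}\dot v_z\\ \dot\phi_z\\ \dot w_z-\dot\phi\\ \dot\Phi_z\\ C_Av_{zz}-C_{I_0}\phi_{zz}-\gamma A^p\dot\Phi_z\\ C_I\phi_{zz}-C_{I_0}v_{zz}+\gamma I_0\dot\Phi_z+\tfrac12G_A\theta\\ \tfrac12G_A\theta_z\\ \tfrac1\mu A^p\Phi_{zz}-\kappa\dot\Phi\end{pmatrix},$$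 whose domain $\mathrm{Dom}(\mathcal A_2)$ consists of all $x\in H^1(0,1)^8$ with $\dot v(0)=\dot\phi(0)=\dot w(0)=\dot\Phi(0)=0$ and, at $z=1$, $C_Av_z-C_{I_0}\phi_z-\gamma A^p\dot\Phi=0$, $C_I\phi_z-C_{I_0}v_z+\gamma I_0\dot\Phi=0$, $\theta=0$, $\Phi_z=0$. **Theorem.** Assume $\rho_A\rho_I\ne\rho_{I_0}^2$ and $C_AC_I\ne C_{I_0}^2$. Then $\|\cdot\|_{\mathcal H}$ is a norm on $L^2(0,1)^8$ equivalent to the usual one, and $\mathcal A_2$ is the generator of a strongly continuous semigroup $T(t)$, $t\ge0$, of contractions with respect to $\|\cdot\|_{\mathcal H}$. In particular, for every $x_0\in\mathrm{Dom}(\mathcal A_2)$ the closed-loop system $\dot x=\mathcal A_2x$, $x(0)=x_0$, has the unique classical solution $x(t)=T(t)x_0$. The energy is a Lyapunov function: along these solutions $$\frac{d}{dt}\mathcal H_T(x(t))=-\int_0^1\kappa\,\dot\Phi(z,t)^2\,dz .$$ The closed-loop system is asymptotically stable: $0$ is Lyapunov stable in $\|\cdot\|_{\mathcal H}$, and $\lim_{t\to\infty}\|T(t)x_0\|_{\mathcal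 H}=0$ for every $x_0\in L^2(0,1)^8$. -/

import Mathlib

open MeasureTheory Set Filter Topology
open scoped NNReal

noncomputable section

namespace PiezoTimoshenko

/-! ### The spaces `L²(0,1)` and `H¹(0,1)` -/

/-- The real Hilbert space `L²(0,1)`. -/
abbrev L2I : Type := Lp ℝ 2 (volume.restrict (Ioo (0 : ℝ) 1))

/-- `u` is an absolutely continuous representative on `[0,1]` of `f ∈ L²(0,1)`, whose
derivative is square integrable. -/
structure IsH1Rep (f : L2I) (u : ℝ → ℝ) : Prop where
  ac : AbsolutelyContinuousOnInterval u 0 1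
  ae_eq : (f : ℝ → ℝ) =ᵐ[volume.restrict (Ioo (0 : ℝ) 1)] u
  memLp : MemLp (deriv u) 2 (volume.restrict (Ioo (0 : ℝ) 1))

theorem IsH1Rep.eqOn {f : L2I} {u v : ℝ → ℝ} (hu : IsH1Rep f u) (hv : IsH1Rep f v) :
    EqOn u v (Icc 0 1) := by
  have hc : ∀ {w : ℝ → ℝ}, IsH1Rep f w → ContinuousOn w (Icc 0 1) := fun hw => by
    simpa [uIcc_of_le (zero_le_one' ℝ)] using hw.ac.continuousOn
  have h : u =ᵐ[volume.restrict (Ioo (0 : ℝ) 1)] v := hu.ae_eq.symm.trans hv.ae_eq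
  refine Measure.eqOn_Icc_of_ae_eq volume zero_ne_one ?_ (hc hu) (hc hv)
  rwa [restrict_Ioo_eq_restrict_Icc] at h

theorem deriv_ae_eq {u v : ℝ → ℝ} (h : EqOn u v (Icc 0 1)) :
    deriv u =ᵐ[volume.restrict (Ioo (0 : ℝ) 1)] deriv v := by
  filter_upwards [ae_restrict_mem measurableSet_Ioo] with z hz
  refine EventuallyEq.deriv_eq ?_
  filter_upwards [Icc_mem_nhds hz.1 hz.2] with y hy using h hy

theorem ae_differentiableAt {f : L2I} {u : ℝ → ℝ} (hu : IsH1Rep f u) :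
    ∀ᵐ z ∂(volume.restrict (Ioo (0 : ℝ) 1)), DifferentiableAt ℝ u z := by
  filter_upwards [ae_restrict_of_ae hu.ac.ae_differentiableAt,
    ae_restrict_mem measurableSet_Ioo] with z hz hm
  exact hz (by rw [uIcc_of_le (zero_le_one' ℝ)]; exact Ioo_subset_Icc_self hm)

theorem deriv_add_ae {f g : L2I} {u v : ℝ → ℝ} (hu : IsH1Rep f u) (hv : IsH1Rep g v) :
    deriv (u + v) =ᵐ[volume.restrict (Ioo (0 : ℝ) 1)] deriv u + deriv v := by
  filter_upwards [ae_differentiableAt hu, ae_differentiableAt hv] with z h1 h2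
  exact deriv_add h1 h2

theorem IsH1Rep.add {f g : L2I} {u v : ℝ → ℝ} (hu : IsH1Rep f u) (hv : IsH1Rep g v) :
    IsH1Rep (f + g) (u + v) where
  ac := hu.ac.add hv.ac
  ae_eq := (Lp.coeFn_add f g).trans (hu.ae_eq.add hv.ae_eq)
  memLp := (hu.memLp.add hv.memLp).ae_eq (deriv_add_ae hu hv).symm

theorem deriv_smul_eq (c : ℝ) (u : ℝ → ℝ) : deriv (c • u) = c • deriv u := by
  funext z
  simp [deriv_const_smul_field]

theorem IsH1Rep.smul {f : L2I} {u : ℝ → ℝ} (c : ℝ) (hu : IsH1Rep f u) :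
    IsH1Rep (c • f) (c • u) where
  ac := hu.ac.const_smul c
  ae_eq := (Lp.coeFn_smul c f).trans (hu.ae_eq.const_smul c)
  memLp := by rw [deriv_smul_eq]; exact hu.memLp.const_smul c

/-- The Sobolev space `H¹(0,1)`: the square integrable functions with an absolutely continuous
representative whose derivative is square integrable. -/
def H1 : Submodule ℝ L2I where
  carrier := {f | ∃ u, IsH1Rep f u}
  add_mem' := by
    rintro f g ⟨u, hu⟩ ⟨v, hv⟩
    exact ⟨_, hu.add hv⟩
  zero_mem' := by
    refine ⟨0, ?_, Lp.coeFn_zero _ _ _, ?_⟩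
    · exact (LipschitzWith.const (0 : ℝ)).lipschitzOnWith.absolutelyContinuousOnInterval
    · have : deriv (0 : ℝ → ℝ) = 0 := by funext z; simp [Pi.zero_def]
      rw [this]; exact MemLp.zero
  smul_mem' := by
    rintro c f ⟨u, hu⟩
    exact ⟨_, hu.smul c⟩

open Classical in
/-- The absolutely continuous representative of an element of `H¹(0,1)`
(unique on `[0,1]`; the value `0` outside `H¹(0,1)` is never used). -/
def rep (f : L2I) : ℝ → ℝ := if h : ∃ u, IsH1Rep f u then h.choose else 0

theorem isH1Rep_rep {f : L2I} (hf : f ∈ H1) : IsH1Rep f (rep f) := by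
  have h : ∃ u, IsH1Rep f u := hf
  rw [rep, dif_pos h]
  exact h.choose_spec

/-- The boundary value of `f ∈ H¹(0,1)` at a point `z ∈ [0,1]`. -/
def bv (z : ℝ) (f : L2I) : ℝ := rep f z

open Classical in
/-- The derivative `f' ∈ L²(0,1)` of `f ∈ H¹(0,1)`
(the value `0` outside `H¹(0,1)` is never used). -/
def D (f : L2I) : L2I := if h : f ∈ H1 then (isH1Rep_rep h).memLp.toLp (deriv (rep f)) else 0

theorem bv_eq {f : L2I} {u : ℝ → ℝ} (hu : IsH1Rep f u) {z : ℝ} (hz : z ∈ Icc (0 : ℝ) 1) :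
    bv z f = u z :=
  (isH1Rep_rep (f := f) ⟨u, hu⟩).eqOn hu hz

theorem D_eq {f : L2I} {u : ℝ → ℝ} (hu : IsH1Rep f u) : D f = hu.memLp.toLp (deriv u) := by
  have hf : f ∈ H1 := ⟨u, hu⟩
  rw [D, dif_pos hf]
  exact MemLp.toLp_congr _ _ (deriv_ae_eq ((isH1Rep_rep hf).eqOn hu))

theorem bv_add {f g : L2I} (hf : f ∈ H1) (hg : g ∈ H1) {z : ℝ} (hz : z ∈ Icc (0 : ℝ) 1) :
    bv z (f + g) = bv z f + bv z g :=
  bv_eq ((isH1Rep_rep hf).add (isH1Rep_rep hg)) hz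

theorem bv_smul {f : L2I} (hf : f ∈ H1) (c : ℝ) {z : ℝ} (hz : z ∈ Icc (0 : ℝ) 1) :
    bv z (c • f) = c * bv z f :=
  bv_eq ((isH1Rep_rep hf).smul c) hz

theorem bv_zero {z : ℝ} (hz : z ∈ Icc (0 : ℝ) 1) : bv z 0 = 0 := by
  have h := bv_smul H1.zero_mem 0 hz
  simpa using h

theorem D_add {f g : L2I} (hf : f ∈ H1) (hg : g ∈ H1) : D (f + g) = D f + D g := by
  have h1 := isH1Rep_rep hf
  have h2 := isH1Rep_rep hg
  rw [D_eq (h1.add h2), D_eq h1, D_eq h2, ← MemLp.toLp_add]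
  exact MemLp.toLp_congr _ _ (deriv_add_ae h1 h2)

theorem D_smul {f : L2I} (hf : f ∈ H1) (c : ℝ) : D (c • f) = c • D f := by
  have h1 := isH1Rep_rep hf
  rw [D_eq (h1.smul c), D_eq h1, ← MemLp.toLp_const_smul]
  exact MemLp.toLp_congr _ _ (by rw [deriv_smul_eq])

/-! ### Strongly continuous semigroups -/

section Semigroup

variable {E : Type*} [NormedAddCommGroup E] [NormedSpace ℝ E]

/-- Strongly continuous semigroups of bounded operators. -/
structure IsC0Semigroup (T : ℝ≥0 → E →L[ℝ] E) : Prop where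
  map_zero : T 0 = ContinuousLinearMap.id ℝ E
  map_add : ∀ s t, T (s + t) = (T s).comp (T t)
  strongly_continuous : ∀ x, Continuous fun t => T t x

/-- `A` is the infinitesimal generator of `T`: the domain of `A` consists of all `x` for which
`(T t x - x) / t` converges as `t ↓ 0`, and `A x` is the limit. -/
def IsGenerator (A : E →ₗ.[ℝ] E) (T : ℝ≥0 → E →L[ℝ] E) : Prop :=
  ∀ x y : E, (x, y) ∈ A.graph ↔
    Tendsto (fun t : ℝ≥0 => (t : ℝ)⁻¹ • (T t x - x)) (𝓝[>] 0) (𝓝 y)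

/-- `u` is a classical solution on `[0,∞)` of `u̇ = A u`, `u(0) = x₀`
(with the one-sided derivative at `t = 0`). -/
def IsClassicalSolution (A : E →ₗ.[ℝ] E) (x₀ : E) (u : ℝ≥0 → E) : Prop :=
  u 0 = x₀ ∧ ∀ t : ℝ≥0, ∃ h : u t ∈ A.domain,
    HasDerivWithinAt (fun s : ℝ => u s.toNNReal) (A ⟨u t, h⟩) (Ici 0) (t : ℝ)

end Semigroup

/-! ### The composite -/

/-- Geometry and material constants of the composite. The substrate (`s`) occupies
`-h₁ ≤ z₃ ≤ h₁`, the piezoelectric layer (`p`) occupies `h₁ ≤ z₃ ≤ h₂`, the width is `2 g_b`,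
and the length is `1`. `ρ`, `C`, `G` are mass density, stiffness and shear modulus; `eps` is the
permittivity, `mu` the magnetic permeability and `gam` the piezoelectric coupling coefficient. -/
structure Composite where
  gb : ℝ
  h₁ : ℝ
  h₂ : ℝ
  ρp : ℝ
  ρs : ℝ
  Cp : ℝ
  Cs : ℝ
  Gp : ℝ
  Gs : ℝ
  eps : ℝ
  mu : ℝ
  gam : ℝ
  gb_pos : 0 < gb
  h₁_pos : 0 < h₁
  h₁_lt_h₂ : h₁ < h₂
  ρp_pos : 0 < ρp
  ρs_pos : 0 < ρs
  Cp_pos : 0 < Cp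
  Cs_pos : 0 < Cs
  Gp_pos : 0 < Gp
  Gs_pos : 0 < Gs
  eps_pos : 0 < eps
  mu_pos : 0 < mu
  gam_ne_zero : gam ≠ 0

/-- The state space `L²(0,1)⁸`, with the states (numbered from `0`)
`(v', φ', θ, Φ', ρ_A v̇ - ρ_{I₀} φ̇, ρ_I φ̇ - ρ_{I₀} v̇, ρ_A ẇ, ε A^p Φ̇ + γ (A^p v' - I₀ φ'))`,
where `θ = w' - φ`. -/
abbrev State : Type := PiLp 2 (fun _ : Fin 8 => L2I)

/-- The `i`-th component of a state. -/
def comp (i : Fin 8) : State →ₗ[ℝ] L2I where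
  toFun x := x i
  map_add' _ _ := rfl
  map_smul' _ _ := rfl

namespace Composite

variable (P : Composite)

/-- Area of the cross-section of the piezoelectric layer. -/
def Ap : ℝ := 2 * P.gb * (P.h₂ - P.h₁)
/-- Area of the cross-section of the substrate. -/
def As : ℝ := 2 * P.gb * (P.h₁ - (-P.h₁))
/-- Second moment of the cross-section of the piezoelectric layer. -/
def Ip : ℝ := 2 / 3 * P.gb * (P.h₂ ^ 3 - P.h₁ ^ 3)
/-- Second moment of the cross-section of the substrate. -/
def Is : ℝ := 2 / 3 * P.gb * (P.h₁ ^ 3 - (-P.h₁) ^ 3)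
/-- First moment of the cross-section of the piezoelectric layer. -/
def I0 : ℝ := P.gb * (P.h₂ ^ 2 - P.h₁ ^ 2)

def ρA : ℝ := P.ρp * P.Ap + P.ρs * P.As
def ρI : ℝ := P.ρp * P.Ip + P.ρs * P.Is
def ρI0 : ℝ := P.ρp * P.I0
def CA : ℝ := P.Cp * P.Ap + P.Cs * P.As
def CI : ℝ := P.Cp * P.Ip + P.Cs * P.Is
def CI0 : ℝ := P.Cp * P.I0
def GA : ℝ := P.Gs * P.As + P.Gp * P.Ap

/-- The longitudinal velocity `v̇` as a function of the state. -/
def vDot : State →ₗ[ℝ] L2I :=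
  (P.ρI / (P.ρA * P.ρI - P.ρI0 ^ 2)) • comp 4 + (P.ρI0 / (P.ρA * P.ρI - P.ρI0 ^ 2)) • comp 5

/-- The angular velocity `φ̇` as a function of the state. -/
def φDot : State →ₗ[ℝ] L2I :=
  (P.ρI0 / (P.ρA * P.ρI - P.ρI0 ^ 2)) • comp 4 + (P.ρA / (P.ρA * P.ρI - P.ρI0 ^ 2)) • comp 5

/-- The transverse velocity `ẇ` as a function of the state. -/
def wDot : State →ₗ[ℝ] L2I := (1 / P.ρA) • comp 6

/-- The electric field `Φ̇` as a function of the state. -/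
def ΦDot : State →ₗ[ℝ] L2I :=
  (1 / (P.eps * P.Ap)) • comp 7 - (P.gam / P.eps) • comp 0
    + (P.gam * P.I0 / (P.eps * P.Ap)) • comp 1

/-- The axial force `C_A v' - C_{I₀} φ' - γ A^p Φ̇`. -/
def axialForce : State →ₗ[ℝ] L2I :=
  P.CA • comp 0 - P.CI0 • comp 1 - (P.gam * P.Ap) • P.ΦDot

/-- The bending moment `C_I φ' - C_{I₀} v' + γ I₀ Φ̇`. -/
def bendingMoment : State →ₗ[ℝ] L2I :=
  P.CI • comp 1 - P.CI0 • comp 0 + (P.gam * P.I0) • P.ΦDot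

/-- The inner product `⟨x, y⟩_ℋ` of the energy space; the inner products on the right are those
of `L²(0,1)`. -/
def energyInner (x y : State) : ℝ :=
  P.ρA * inner ℝ (P.vDot x) (P.vDot y) + P.ρI * inner ℝ (P.φDot x) (P.φDot y)
    - P.ρI0 * (inner ℝ (P.vDot x) (P.φDot y) + inner ℝ (P.φDot x) (P.vDot y))
    + P.ρA * inner ℝ (P.wDot x) (P.wDot y)
    + P.eps * P.Ap * inner ℝ (P.ΦDot x) (P.ΦDot y)
    + P.CA * inner ℝ (x 0) (y 0) + P.CI * inner ℝ (x 1) (y 1)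
    - P.CI0 * (inner ℝ (x 0) (y 1) + inner ℝ (x 1) (y 0))
    + 1 / 2 * P.GA * inner ℝ (x 2) (y 2)
    + 1 / P.mu * P.Ap * inner ℝ (x 3) (y 3)

/-- The total energy `ℋ_T`. -/
def energy (x : State) : ℝ := 1 / 2 * P.energyInner x x

/-- The norm `‖x‖_ℋ = √⟨x, x⟩_ℋ` of the energy space. -/
def energyNorm (x : State) : ℝ := √(P.energyInner x x)

/-- The (distributed) current feedback `ℐ = κ / (h₂ - h₁) Φ̇`. -/
def current (κ : ℝ) : State →ₗ[ℝ] L2I := (κ / (P.h₂ - P.h₁)) • P.ΦDot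

theorem vDot_mem {x : State} (h : ∀ i, x i ∈ H1) : P.vDot x ∈ H1 :=
  H1.add_mem (H1.smul_mem _ (h 4)) (H1.smul_mem _ (h 5))

theorem φDot_mem {x : State} (h : ∀ i, x i ∈ H1) : P.φDot x ∈ H1 :=
  H1.add_mem (H1.smul_mem _ (h 4)) (H1.smul_mem _ (h 5))

theorem wDot_mem {x : State} (h : ∀ i, x i ∈ H1) : P.wDot x ∈ H1 :=
  H1.smul_mem _ (h 6)

theorem ΦDot_mem {x : State} (h : ∀ i, x i ∈ H1) : P.ΦDot x ∈ H1 :=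
  H1.add_mem (H1.sub_mem (H1.smul_mem _ (h 7)) (H1.smul_mem _ (h 0))) (H1.smul_mem _ (h 1))

theorem axialForce_mem {x : State} (h : ∀ i, x i ∈ H1) : P.axialForce x ∈ H1 :=
  H1.sub_mem (H1.sub_mem (H1.smul_mem _ (h 0)) (H1.smul_mem _ (h 1)))
    (H1.smul_mem _ (P.ΦDot_mem h))

theorem bendingMoment_mem {x : State} (h : ∀ i, x i ∈ H1) : P.bendingMoment x ∈ H1 :=
  H1.add_mem (H1.sub_mem (H1.smul_mem _ (h 1)) (H1.smul_mem _ (h 0)))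
    (H1.smul_mem _ (P.ΦDot_mem h))

/-- The domain of the closed-loop operator: `x ∈ H¹(0,1)⁸` with the essential boundary conditions
at the clamped end `z = 0` and the natural boundary conditions at the free end `z = 1`. -/
def domain : Submodule ℝ State where
  carrier := {x | (∀ i, x i ∈ H1) ∧
    bv 0 (P.vDot x) = 0 ∧ bv 0 (P.φDot x) = 0 ∧ bv 0 (P.wDot x) = 0 ∧ bv 0 (P.ΦDot x) = 0 ∧
    bv 1 (P.axialForce x) = 0 ∧ bv 1 (P.bendingMoment x) = 0 ∧
    bv 1 (x 2) = 0 ∧ bv 1 (x 3) = 0}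
  add_mem' := by
    rintro x y ⟨hx, x1, x2, x3, x4, x5, x6, x7, x8⟩ ⟨hy, y1, y2, y3, y4, y5, y6, y7, y8⟩
    have m0 : (0 : ℝ) ∈ Icc (0 : ℝ) 1 := by simp
    have m1 : (1 : ℝ) ∈ Icc (0 : ℝ) 1 := by simp
    refine ⟨fun i => H1.add_mem (hx i) (hy i), ?_, ?_, ?_, ?_, ?_, ?_, ?_, ?_⟩
    · rw [map_add, bv_add (P.vDot_mem hx) (P.vDot_mem hy) m0, x1, y1, add_zero]
    · rw [map_add, bv_add (P.φDot_mem hx) (P.φDot_mem hy) m0, x2, y2, add_zero]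
    · rw [map_add, bv_add (P.wDot_mem hx) (P.wDot_mem hy) m0, x3, y3, add_zero]
    · rw [map_add, bv_add (P.ΦDot_mem hx) (P.ΦDot_mem hy) m0, x4, y4, add_zero]
    · rw [map_add, bv_add (P.axialForce_mem hx) (P.axialForce_mem hy) m1, x5, y5, add_zero]
    · rw [map_add, bv_add (P.bendingMoment_mem hx) (P.bendingMoment_mem hy) m1, x6, y6,
        add_zero]
    · rw [PiLp.add_apply, bv_add (hx 2) (hy 2) m1, x7, y7, add_zero]
    · rw [PiLp.add_apply, bv_add (hx 3) (hy 3) m1, x8, y8, add_zero]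
  zero_mem' := by
    have m0 : (0 : ℝ) ∈ Icc (0 : ℝ) 1 := by simp
    have m1 : (1 : ℝ) ∈ Icc (0 : ℝ) 1 := by simp
    refine ⟨fun i => H1.zero_mem, ?_, ?_, ?_, ?_, ?_, ?_, ?_, ?_⟩ <;>
      simp [bv_zero m0, bv_zero m1]
  smul_mem' := by
    rintro c x ⟨hx, x1, x2, x3, x4, x5, x6, x7, x8⟩
    have m0 : (0 : ℝ) ∈ Icc (0 : ℝ) 1 := by simp
    have m1 : (1 : ℝ) ∈ Icc (0 : ℝ) 1 := by simp
    refine ⟨fun i => H1.smul_mem c (hx i), ?_, ?_, ?_, ?_, ?_, ?_, ?_, ?_⟩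
    · rw [map_smul, bv_smul (P.vDot_mem hx) c m0, x1, mul_zero]
    · rw [map_smul, bv_smul (P.φDot_mem hx) c m0, x2, mul_zero]
    · rw [map_smul, bv_smul (P.wDot_mem hx) c m0, x3, mul_zero]
    · rw [map_smul, bv_smul (P.ΦDot_mem hx) c m0, x4, mul_zero]
    · rw [map_smul, bv_smul (P.axialForce_mem hx) c m1, x5, mul_zero]
    · rw [map_smul, bv_smul (P.bendingMoment_mem hx) c m1, x6, mul_zero]
    · rw [PiLp.smul_apply, bv_smul (hx 2) c m1, x7, mul_zero]
    · rw [PiLp.smul_apply, bv_smul (hx 3) c m1, x8, mul_zero]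

/-- The right-hand side of the closed-loop system, with the input current `ℐ` given by the
feedback `current κ`. -/
def rhs (κ : ℝ) (x : State) : State :=
  WithLp.toLp 2 ![
    D (P.vDot x),
    D (P.φDot x),
    D (P.wDot x) - P.φDot x,
    D (P.ΦDot x),
    D (P.axialForce x),
    D (P.bendingMoment x) + (1 / 2 * P.GA) • x 2,
    (1 / 2 * P.GA) • D (x 2),
    (1 / P.mu * P.Ap) • D (x 3) - (P.h₂ - P.h₁) • P.current κ x]

theorem rhs_add (κ : ℝ) {x y : State} (hx : ∀ i, x i ∈ H1) (hy : ∀ i, y i ∈ H1) :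
    P.rhs κ (x + y) = P.rhs κ x + P.rhs κ y := by
  have e1 := D_add (P.vDot_mem hx) (P.vDot_mem hy)
  have e2 := D_add (P.φDot_mem hx) (P.φDot_mem hy)
  have e3 := D_add (P.wDot_mem hx) (P.wDot_mem hy)
  have e4 := D_add (P.ΦDot_mem hx) (P.ΦDot_mem hy)
  have e5 := D_add (P.axialForce_mem hx) (P.axialForce_mem hy)
  have e6 := D_add (P.bendingMoment_mem hx) (P.bendingMoment_mem hy)
  have e7 := D_add (hx 2) (hy 2)
  have e8 := D_add (hx 3) (hy 3)
  ext1 i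
  fin_cases i <;> simp [rhs, e1, e2, e3, e4, e5, e6, e7, e8] <;> abel

theorem rhs_smul (κ c : ℝ) {x : State} (hx : ∀ i, x i ∈ H1) :
    P.rhs κ (c • x) = c • P.rhs κ x := by
  have e1 := D_smul (P.vDot_mem hx) c
  have e2 := D_smul (P.φDot_mem hx) c
  have e3 := D_smul (P.wDot_mem hx) c
  have e4 := D_smul (P.ΦDot_mem hx) c
  have e5 := D_smul (P.axialForce_mem hx) c
  have e6 := D_smul (P.bendingMoment_mem hx) c
  have e7 := D_smul (hx 2) c
  have e8 := D_smul (hx 3) c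
  ext1 i
  fin_cases i <;> simp [rhs, e1, e2, e3, e4, e5, e6, e7, e8, smul_sub, smul_comm c]

/-- The closed-loop operator `𝒜₂`. -/
def closedLoop (κ : ℝ) : State →ₗ.[ℝ] State where
  domain := P.domain
  toFun :=
    { toFun := fun x => P.rhs κ x
      map_add' := fun x y => P.rhs_add κ x.2.1 y.2.1
      map_smul' := fun c x => P.rhs_smul κ c x.2.1 }

/-- Asymptotic stability of the equilibrium `0` in the energy norm: Lyapunov stability together
with global attractivity. -/
def AsymptoticallyStable (T : ℝ≥0 → State →L[ℝ] State) : Prop :=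
  (∀ r > 0, ∃ δ > 0, ∀ x, P.energyNorm x < δ → ∀ t, P.energyNorm (T t x) < r) ∧
  ∀ x, Tendsto (fun t => P.energyNorm (T t x)) atTop (𝓝 0)

end Composite

end PiezoTimoshenko

end

noncomputable section

namespace PiezoTimoshenko

/-! ### Primitives, integration by parts and the compactness of the Volterra operator -/

/-! In the energy inner product `⟨x, 𝒜₂ x⟩ = -κ‖Φ̇‖²`: velocities vanish at `z = 0` and forces at `z
= 1`, so integration by parts leaves only the feedback term. Moreover `𝒜₂` has an explicit compact
inverse `B = invOp`, obtained by integrating velocities from `0` and forces from `1`. The whole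
argument runs through this bounded `B`: `x` lies in the domain with `𝒜₂ x = y` exactly when `x = B
y` (`mem_graph_closedLoop`), and dissipativity reads `⟨B y, y⟩ ≤ 0`.

Generation (`exists_isInverseGenerated`): the operators `(B - ε)⁻¹` are bounded and dissipative,
their exponentials are contractions, and these converge strongly as `ε → 0` to a semigroup with
generator `B⁻¹`.

Stability (`tendsto_norm_zero`) is LaSalle's principle. Compactness of `B` makes the orbits starting
in its range precompact, and their limit points have orbits of constant norm. States with such
orbits form a set invariant under `B` and the semigroup, on which `Φ̇(B y) = 0`.

It remains to see that this set is trivial (`IsUnobservable.eq_zero`). If `Φ̇` vanishes identically,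
the electric equation forces `v' = m φ'`, with `m` the height of the piezoelectric center line. The
axial equation becomes `ρs φ̈ = Cs φ''`, and the moment equation reduces to `½ G_A θ = J (ρp - Cp ρs
/ Cs) φ̈`. For equal wave speeds `θ = 0`, so `ẇ = 0` and then `φ̇ = 0`. Otherwise `θ = 0` at the
free end gives `φ̈ = 0` there besides `φ' = 0`, and the multiplier `z φ'` kills this overdetermined
wave equation. Either way `φ̇ = 0`, and everything else vanishes with it. -/

theorem zero_mem_I : (0 : ℝ) ∈ Icc (0 : ℝ) 1 := by simp
theorem one_mem_I : (1 : ℝ) ∈ Icc (0 : ℝ) 1 := by simp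

theorem inner_L2I (f g : L2I) : inner ℝ f g = ∫ z in Ioo (0 : ℝ) 1, f z * g z := by
  rw [L2.inner_def]
  refine integral_congr_ae (Eventually.of_forall fun z => ?_)
  simp [mul_comm]

theorem norm_sq_L2I (f : L2I) : ‖f‖ ^ 2 = ∫ z in Ioo (0 : ℝ) 1, f z ^ 2 := by
  rw [← real_inner_self_eq_norm_sq, inner_L2I]
  simp only [sq]

theorem setIntegral_Ioo_eq (u : ℝ → ℝ) : ∫ z in Ioo (0 : ℝ) 1, u z = ∫ z in (0 : ℝ)..1, u z := by
  rw [intervalIntegral.integral_of_le zero_le_one, integral_Ioc_eq_integral_Ioo]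

theorem intervalIntegrable_L2I (f : L2I) : IntervalIntegrable f volume 0 1 := by
  rw [intervalIntegrable_iff_integrableOn_Ioo_of_le zero_le_one]
  exact (Lp.memLp f).integrable (by norm_num)

theorem D_ae_eq {f : L2I} {u : ℝ → ℝ} (hu : IsH1Rep f u) :
    (D f : ℝ → ℝ) =ᵐ[volume.restrict (Ioo (0 : ℝ) 1)] deriv u := by
  rw [D_eq hu]
  exact hu.memLp.coeFn_toLp

theorem inner_D_add_inner_D {f g : L2I} (hf : f ∈ H1) (hg : g ∈ H1) :
    inner ℝ (D f) g + inner ℝ f (D g) = bv 1 f * bv 1 g - bv 0 f * bv 0 g := by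
  have hu := isH1Rep_rep hf
  have hv := isH1Rep_rep hg
  have key := AbsolutelyContinuousOnInterval.integral_deriv_mul_eq_sub hu.ac hv.ac
  rw [← setIntegral_Ioo_eq] at key
  unfold bv
  rw [← key, inner_L2I, inner_L2I, ← integral_add]
  · refine integral_congr_ae ?_
    filter_upwards [D_ae_eq hu, D_ae_eq hv, hu.ae_eq, hv.ae_eq] with z h1 h2 h3 h4
    rw [h1, h2, h3, h4]
  · exact (Lp.memLp (D f)).integrable_mul (Lp.memLp g)
  · exact (Lp.memLp f).integrable_mul (Lp.memLp (D g))

/-- The primitive of `f` vanishing at `0`. -/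
def prim (f : L2I) (z : ℝ) : ℝ := ∫ s in (0 : ℝ)..z, f s

theorem prim_ac (f : L2I) : AbsolutelyContinuousOnInterval (prim f) 0 1 :=
  (intervalIntegrable_L2I f).absolutelyContinuousOnInterval_intervalIntegral (by simp)

theorem prim_deriv (f : L2I) :
    deriv (prim f) =ᵐ[volume.restrict (Ioo (0 : ℝ) 1)] f := by
  have h := (intervalIntegrable_L2I f).ae_hasDerivAt_integral
  filter_upwards [ae_restrict_of_ae h, ae_restrict_mem measurableSet_Ioo] with z hz hm
  exact (hz (by simpa using Ioo_subset_Icc_self hm) 0 (by simp)).deriv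

/-- Cauchy–Schwarz against the indicator of `(a, b)`. This Hölder-½ modulus drives the compactness
of `V`. -/
theorem abs_prim_sub_le (f : L2I) {a b : ℝ} (ha : a ∈ Icc (0 : ℝ) 1) (hb : b ∈ Icc (0 : ℝ) 1)
    (hab : a ≤ b) : |prim f b - prim f a| ≤ √(b - a) * ‖f‖ := by
  have hsub : Ioo a b ⊆ Ioo (0 : ℝ) 1 := Ioo_subset_Ioo ha.1 hb.2
  have hint : ∀ c ∈ Icc (0 : ℝ) 1, ∀ d ∈ Icc (0 : ℝ) 1, IntervalIntegrable f volume c d := by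
    intro c hc d hd
    refine (intervalIntegrable_L2I f).mono_set ?_
    rw [uIcc_of_le (zero_le_one' ℝ)]
    exact uIcc_subset_Icc hc hd
  have h1 : prim f b - prim f a = ∫ z in Ioo a b, f z := by
    rw [prim, prim, intervalIntegral.integral_interval_sub_left
      (hint 0 zero_mem_I b hb) (hint 0 zero_mem_I a ha),
      intervalIntegral.integral_of_le hab, integral_Ioc_eq_integral_Ioo]
  have hμ : (volume.restrict (Ioo (0 : ℝ) 1)) (Ioo a b) ≠ ⊤ := by
    exact measure_ne_top _ _
  have h2 : ∫ z in Ioo a b, f z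
      = inner ℝ (indicatorConstLp 2 measurableSet_Ioo hμ (1 : ℝ)) f := by
    rw [L2.inner_indicatorConstLp_one, Measure.restrict_restrict measurableSet_Ioo,
      inter_eq_left.2 hsub]
  rw [h1, h2]
  refine (abs_real_inner_le_norm _ _).trans ?_
  refine mul_le_mul_of_nonneg_right ?_ (norm_nonneg _)
  rw [norm_indicatorConstLp (by norm_num) (by norm_num), measureReal_restrict_apply measurableSet_Ioo,
    inter_eq_left.2 hsub, Real.volume_real_Ioo_of_le hab, Real.sqrt_eq_rpow]
  simp

theorem prim_zero (f : L2I) : prim f 0 = 0 := by simp [prim]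

theorem abs_prim_le (f : L2I) {z : ℝ} (hz : z ∈ Icc (0 : ℝ) 1) : |prim f z| ≤ ‖f‖ := by
  have h := abs_prim_sub_le f zero_mem_I hz hz.1
  rw [prim_zero, sub_zero, sub_zero] at h
  refine h.trans (mul_le_of_le_one_left (norm_nonneg _) ?_)
  exact Real.sqrt_le_one.2 hz.2

theorem memLp_of_ac {u : ℝ → ℝ} (hu : AbsolutelyContinuousOnInterval u 0 1) :
    MemLp u 2 (volume.restrict (Ioo (0 : ℝ) 1)) := by
  obtain ⟨C, hC⟩ := hu.exists_bound
  have hc := hu.continuousOn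
  rw [uIcc_of_le (zero_le_one' ℝ)] at hC hc
  refine MemLp.of_bound ((hc.mono Ioo_subset_Icc_self).aestronglyMeasurable measurableSet_Ioo) C ?_
  filter_upwards [ae_restrict_mem measurableSet_Ioo] with z hz
  exact hC z (Ioo_subset_Icc_self hz)

theorem norm_le_of_ae_bound {f : L2I} {C : ℝ} (hC : 0 ≤ C)
    (h : ∀ᵐ z ∂(volume.restrict (Ioo (0 : ℝ) 1)), ‖f z‖ ≤ C) : ‖f‖ ≤ C := by
  have hone : measureUnivNNReal (volume.restrict (Ioo (0 : ℝ) 1)) = 1 := by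
    simp [measureUnivNNReal]
  simpa [hone] using Lp.norm_le_of_ae_bound hC h

theorem prim_add (f g : L2I) {z : ℝ} (hz : z ∈ Icc (0 : ℝ) 1) :
    prim (f + g) z = prim f z + prim g z := by
  have hint : ∀ f : L2I, IntervalIntegrable f volume 0 z := by
    intro f
    refine (intervalIntegrable_L2I f).mono_set ?_
    rw [uIcc_of_le (zero_le_one' ℝ)]
    exact uIcc_subset_Icc zero_mem_I hz
  rw [prim, prim, prim, ← intervalIntegral.integral_add (hint f) (hint g)]
  simp only [intervalIntegral.integral_of_le hz.1, integral_Ioc_eq_integral_Ioo]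
  exact integral_congr_ae (ae_restrict_of_ae_restrict_of_subset
    (Ioo_subset_Ioo_right hz.2) (Lp.coeFn_add f g))

theorem prim_smul (c : ℝ) (f : L2I) {z : ℝ} (hz : z ∈ Icc (0 : ℝ) 1) :
    prim (c • f) z = c * prim f z := by
  rw [prim, prim, ← intervalIntegral.integral_const_mul]
  simp only [intervalIntegral.integral_of_le hz.1, integral_Ioc_eq_integral_Ioo]
  exact integral_congr_ae (ae_restrict_of_ae_restrict_of_subset
    (Ioo_subset_Ioo_right hz.2) (Lp.coeFn_smul c f))

/-- The Volterra operator `f ↦ ∫₀ᶻ f`. -/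
def V : L2I →L[ℝ] L2I :=
  LinearMap.mkContinuous
    { toFun := fun f => (memLp_of_ac (prim_ac f)).toLp (prim f)
      map_add' := fun f g => by
        rw [← MemLp.toLp_add]
        refine MemLp.toLp_congr _ _ ?_
        filter_upwards [ae_restrict_mem measurableSet_Ioo] with z hz
        exact prim_add f g (Ioo_subset_Icc_self hz)
      map_smul' := fun c f => by
        rw [RingHom.id_apply, ← MemLp.toLp_const_smul]
        refine MemLp.toLp_congr _ _ ?_
        filter_upwards [ae_restrict_mem measurableSet_Ioo] with z hz
        exact prim_smul c f (Ioo_subset_Icc_self hz) } 1 (fun f => by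
    rw [one_mul]
    refine norm_le_of_ae_bound (norm_nonneg f) ?_
    filter_upwards [ae_restrict_mem measurableSet_Ioo,
      (memLp_of_ac (prim_ac f)).coeFn_toLp] with z hz h
    exact (congrArg norm h).le.trans (abs_prim_le f (Ioo_subset_Icc_self hz)))

theorem V_ae_eq (f : L2I) : (V f : ℝ → ℝ) =ᵐ[volume.restrict (Ioo (0 : ℝ) 1)] prim f :=
  (memLp_of_ac (prim_ac f)).coeFn_toLp

theorem isH1Rep_V (f : L2I) : IsH1Rep (V f) (prim f) where
  ac := prim_ac f
  ae_eq := V_ae_eq f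
  memLp := (Lp.memLp f).ae_eq (prim_deriv f).symm

theorem V_mem (f : L2I) : V f ∈ H1 := ⟨_, isH1Rep_V f⟩

theorem bv_zero_V (f : L2I) : bv 0 (V f) = 0 := by
  rw [bv_eq (isH1Rep_V f) zero_mem_I, prim_zero]

theorem D_V (f : L2I) : D (V f) = f :=
  Lp.ext ((D_ae_eq (isH1Rep_V f)).trans (prim_deriv f))

theorem ae_eq_prim_D_add {f : L2I} (hf : f ∈ H1) :
    (f : ℝ → ℝ) =ᵐ[volume.restrict (Ioo (0 : ℝ) 1)] fun z => prim (D f) z + bv 0 f := by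
  have hu := isH1Rep_rep hf
  filter_upwards [hu.ae_eq, ae_restrict_mem measurableSet_Ioo] with z hz hm
  have h := (hu.ac.mono (c := 0) (d := z) (by
    rw [uIcc_of_le hm.1.le, uIcc_of_le zero_le_one]
    exact Icc_subset_Icc_right hm.2.le)).integral_deriv_eq_sub
  have h' : prim (D f) z = ∫ s in (0 : ℝ)..z, deriv (rep f) s := by
    simp only [prim, intervalIntegral.integral_of_le hm.1.le, integral_Ioc_eq_integral_Ioo]
    exact integral_congr_ae (ae_restrict_of_ae_restrict_of_subset
      (Ioo_subset_Ioo_right hm.2.le) (D_ae_eq hu))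
  rw [hz, h', h, bv]
  ring

theorem V_D {f : L2I} (hf : f ∈ H1) (h0 : bv 0 f = 0) : V (D f) = f := by
  refine Lp.ext ?_
  filter_upwards [V_ae_eq (D f), ae_eq_prim_D_add hf] with z h1 h2
  rw [h1, h2, h0, add_zero]

/-- The constant function `1`. -/
def one : L2I := (memLp_const (1 : ℝ)).toLp _

theorem isH1Rep_one : IsH1Rep one (fun _ => 1) where
  ac := (LipschitzWith.const (1 : ℝ)).lipschitzOnWith.absolutelyContinuousOnInterval
  ae_eq := (memLp_const (1 : ℝ)).coeFn_toLp
  memLp := by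
    have : deriv (fun _ : ℝ => (1 : ℝ)) = 0 := by funext z; simp
    rw [this]; exact MemLp.zero

theorem one_mem : one ∈ H1 := ⟨_, isH1Rep_one⟩

theorem bv_one {z : ℝ} (hz : z ∈ Icc (0 : ℝ) 1) : bv z one = 1 := bv_eq isH1Rep_one hz

theorem D_one : D one = 0 := by
  refine Lp.ext ((D_ae_eq isH1Rep_one).trans ?_)
  filter_upwards [Lp.coeFn_zero ℝ 2 (volume.restrict (Ioo (0 : ℝ) 1))] with z hz
  rw [hz, deriv_const]
  rfl

theorem bv_one_V (f : L2I) : bv 1 (V f) = inner ℝ one f := by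
  have h := inner_D_add_inner_D one_mem (V_mem f)
  rw [D_one, D_V, bv_zero_V, bv_one one_mem_I] at h
  simpa using h.symm

/-- The operator `f ↦ -∫_z^1 f`. -/
def V₁ : L2I →L[ℝ] L2I := V - (innerSL ℝ one).smulRight one

theorem V₁_apply (f : L2I) : V₁ f = V f + (-inner ℝ one f) • one := by
  simp [V₁, sub_eq_add_neg]

theorem V₁_mem (f : L2I) : V₁ f ∈ H1 := by
  rw [V₁_apply]
  exact H1.add_mem (V_mem f) (H1.smul_mem _ one_mem)

theorem bv_one_V₁ (f : L2I) : bv 1 (V₁ f) = 0 := by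
  rw [V₁_apply, bv_add (V_mem f) (H1.smul_mem _ one_mem) one_mem_I,
    bv_smul one_mem _ one_mem_I, bv_one one_mem_I, bv_one_V]
  ring

theorem D_V₁ (f : L2I) : D (V₁ f) = f := by
  rw [V₁_apply, D_add (V_mem f) (H1.smul_mem _ one_mem), D_smul one_mem, D_one, D_V]
  simp

theorem bv_sub {f g : L2I} (hf : f ∈ H1) (hg : g ∈ H1) {z : ℝ} (hz : z ∈ Icc (0 : ℝ) 1) :
    bv z (f - g) = bv z f - bv z g := by
  rw [sub_eq_add_neg, ← neg_one_smul ℝ g, bv_add hf (H1.smul_mem _ hg) hz, bv_smul hg _ hz]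
  ring

theorem D_sub {f g : L2I} (hf : f ∈ H1) (hg : g ∈ H1) : D (f - g) = D f - D g := by
  rw [sub_eq_add_neg, ← neg_one_smul ℝ g, D_add hf (H1.smul_mem _ hg), D_smul hg]
  simp [sub_eq_add_neg]

theorem eq_smul_one_of_D_eq_zero {f : L2I} (hf : f ∈ H1) (h : D f = 0) : f = bv 0 f • one := by
  have h1 : V (D (f - bv 0 f • one)) = f - bv 0 f • one := by
    refine V_D (H1.sub_mem hf (H1.smul_mem _ one_mem)) ?_
    rw [bv_sub hf (H1.smul_mem _ one_mem) zero_mem_I, bv_smul one_mem _ zero_mem_I,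
      bv_one zero_mem_I]
    ring
  rw [D_sub hf (H1.smul_mem _ one_mem), D_smul one_mem, D_one, h] at h1
  simp only [smul_zero, sub_self, map_zero] at h1
  exact (sub_eq_zero.1 h1.symm)

/-- `f` and `V₁ (D f)` have the same derivative, so they differ by a constant, which the condition
at `z = 1` makes zero. -/
theorem V₁_D {f : L2I} (hf : f ∈ H1) (h1 : bv 1 f = 0) : V₁ (D f) = f := by
  have hm : f - V₁ (D f) ∈ H1 := H1.sub_mem hf (V₁_mem _)
  have h2 := eq_smul_one_of_D_eq_zero hm (by rw [D_sub hf (V₁_mem _), D_V₁, sub_self])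
  have h3 : bv 1 (f - V₁ (D f)) = 0 := by
    rw [bv_sub hf (V₁_mem _) one_mem_I, h1, bv_one_V₁, sub_zero]
  have h4 : bv 0 (f - V₁ (D f)) = 0 := by
    rw [h2, bv_smul one_mem _ one_mem_I, bv_one one_mem_I, mul_one] at h3
    exact h3
  rw [h4, zero_smul] at h2
  exact (sub_eq_zero.1 h2).symm

/-! #### Multiplication by the coordinate -/

theorem memLp_coord_mul (f : L2I) :
    MemLp (fun z => z * f z) 2 (volume.restrict (Ioo (0 : ℝ) 1)) := by
  refine (Lp.memLp f).of_le (continuous_id.aestronglyMeasurable.mul (Lp.aestronglyMeasurable f)) ?_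
  filter_upwards [ae_restrict_mem measurableSet_Ioo] with z hz
  rw [norm_mul]
  refine mul_le_of_le_one_left (norm_nonneg _) ?_
  rw [Real.norm_eq_abs, abs_of_pos hz.1]
  exact hz.2.le

/-- Multiplication by the coordinate `z`. -/
def Z : L2I →L[ℝ] L2I :=
  LinearMap.mkContinuous
    { toFun := fun f => (memLp_coord_mul f).toLp _
      map_add' := fun f g => by
        rw [← MemLp.toLp_add]
        refine MemLp.toLp_congr _ _ ?_
        filter_upwards [Lp.coeFn_add f g] with z hz
        exact (congrArg (z * ·) hz).trans (mul_add _ _ _)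
      map_smul' := fun c f => by
        rw [RingHom.id_apply, ← MemLp.toLp_const_smul]
        refine MemLp.toLp_congr _ _ ?_
        filter_upwards [Lp.coeFn_smul c f] with z hz
        exact (congrArg (z * ·) hz).trans (mul_left_comm _ _ _) } 1 (fun f => by
    rw [one_mul]
    refine Lp.norm_le_norm_of_ae_le ?_
    filter_upwards [ae_restrict_mem measurableSet_Ioo,
      (memLp_coord_mul f).coeFn_toLp] with z hz h
    refine (congrArg norm h).le.trans ?_
    rw [norm_mul]
    refine mul_le_of_le_one_left (norm_nonneg _) ?_
    rw [Real.norm_eq_abs, abs_of_pos hz.1]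
    exact hz.2.le)

theorem Z_ae_eq (f : L2I) :
    (Z f : ℝ → ℝ) =ᵐ[volume.restrict (Ioo (0 : ℝ) 1)] fun z => z * f z :=
  (memLp_coord_mul f).coeFn_toLp

theorem inner_Z_comm (f g : L2I) : inner ℝ (Z f) g = inner ℝ f (Z g) := by
  rw [inner_L2I, inner_L2I]
  refine integral_congr_ae ?_
  filter_upwards [Z_ae_eq f, Z_ae_eq g] with z h1 h2
  rw [h1, h2]
  ring

theorem deriv_coord_mul {f : L2I} (hf : f ∈ H1) :
    deriv (fun z => z * rep f z) =ᵐ[volume.restrict (Ioo (0 : ℝ) 1)] (f + Z (D f) : L2I) := by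
  have hu := isH1Rep_rep hf
  filter_upwards [ae_differentiableAt hu, hu.ae_eq, D_ae_eq hu, Z_ae_eq (D f),
    Lp.coeFn_add f (Z (D f))] with z h1 h2 h3 h4 h5
  rw [h5, Pi.add_apply, h4, h3, h2, ((hasDerivAt_id' z).fun_mul h1.hasDerivAt).deriv, one_mul]

theorem isH1Rep_Z {f : L2I} (hf : f ∈ H1) : IsH1Rep (Z f) (fun z => z * rep f z) where
  ac := AbsolutelyContinuousOnInterval.mul
    (f := fun z => z) (LipschitzWith.id.lipschitzOnWith.absolutelyContinuousOnInterval)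
    (isH1Rep_rep hf).ac
  ae_eq := by
    filter_upwards [Z_ae_eq f, (isH1Rep_rep hf).ae_eq] with z h1 h2
    rw [h1, h2]
  memLp := (Lp.memLp _).ae_eq (deriv_coord_mul hf).symm

/-- The multiplier identity `z f f' = ½ (z f²)' - ½ f²`, integrated; the weight `z` removes the
boundary term at `0`. -/
theorem inner_Z_D {f : L2I} (hf : f ∈ H1) :
    inner ℝ (Z (D f)) f = (bv 1 f ^ 2 - ‖f‖ ^ 2) / 2 := by
  have h := inner_D_add_inner_D hf ⟨_, isH1Rep_Z hf⟩
  have hD : D (Z f) = f + Z (D f) := Lp.ext ((D_ae_eq (isH1Rep_Z hf)).trans (deriv_coord_mul hf))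
  rw [bv_eq (isH1Rep_Z hf) one_mem_I, bv_eq (isH1Rep_Z hf) zero_mem_I, hD, inner_add_right,
    real_inner_self_eq_norm_sq, ← inner_Z_comm, real_inner_comm (Z (D f)) f] at h
  have : rep f 1 = bv 1 f := rfl
  rw [this] at h
  linarith

/-! #### Compactness -/

theorem memLp_step (n : ℕ) (a : Fin (n + 1) → ℝ) :
    MemLp (fun z : ℝ => a (Fin.ofNat (n + 1) ⌊(n + 1) * z⌋₊)) 2
      (volume.restrict (Ioo (0 : ℝ) 1)) := by
  refine MemLp.of_bound ?_ ‖a‖ (Eventually.of_forall fun z => norm_le_pi_norm a _)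
  have h1 : Measurable fun k : ℕ => a (Fin.ofNat (n + 1) k) := measurable_from_nat
  have h2 : Measurable fun z : ℝ => ⌊(n + 1) * z⌋₊ :=
    Nat.measurable_floor.comp (measurable_const.mul measurable_id)
  exact (h1.comp h2).aestronglyMeasurable

/-- The step function with the given values on the intervals of a uniform partition. -/
def step (n : ℕ) : (Fin (n + 1) → ℝ) →L[ℝ] L2I :=
  LinearMap.toContinuousLinearMap
    { toFun := fun a => (memLp_step n a).toLp _
      map_add' := fun a b => by rw [← MemLp.toLp_add]; rfl
      map_smul' := fun c a => by rw [RingHom.id_apply, ← MemLp.toLp_const_smul]; rfl }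

theorem grid_mem (n : ℕ) (k : Fin (n + 1)) : (k : ℝ) / (n + 1) ∈ Icc (0 : ℝ) 1 := by
  have : (k : ℝ) < n + 1 := by exact_mod_cast k.2
  refine ⟨by positivity, ?_⟩
  rw [div_le_one (by positivity)]
  exact this.le

/-- The values of the primitive on a uniform grid. -/
def grid (n : ℕ) : L2I →L[ℝ] (Fin (n + 1) → ℝ) :=
  LinearMap.mkContinuous
    { toFun := fun f k => prim f ((k : ℝ) / (n + 1))
      map_add' := fun f g => by funext k; exact prim_add f g (grid_mem n k)
      map_smul' := fun c f => by funext k; exact prim_smul c f (grid_mem n k) } 1 (fun f => by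
    rw [one_mul]
    exact (pi_norm_le_iff_of_nonneg (norm_nonneg f)).2 fun k => abs_prim_le f (grid_mem n k))

/-- On each cell of the grid the primitive moves by at most `√(1/(n+1)) ‖f‖`, so `V` is a norm limit
of finite-rank operators. -/
theorem norm_V_sub_step_le (n : ℕ) : ‖V - (step n).comp (grid n)‖ ≤ √(1 / (n + 1)) := by
  refine ContinuousLinearMap.opNorm_le_bound _ (Real.sqrt_nonneg _) fun f => ?_
  refine norm_le_of_ae_bound (by positivity) ?_
  have hs : (step n (grid n f) : ℝ → ℝ) =ᵐ[volume.restrict (Ioo (0 : ℝ) 1)]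
      fun z => grid n f (Fin.ofNat (n + 1) ⌊(n + 1) * z⌋₊) := (memLp_step n (grid n f)).coeFn_toLp
  have hsub : ((V - (step n).comp (grid n)) f) = V f - step n (grid n f) := by simp
  rw [hsub]
  filter_upwards [Lp.coeFn_sub (V f) (step n (grid n f)), V_ae_eq f, hs,
    ae_restrict_mem measurableSet_Ioo] with z h1 h2 h3 hz
  have hn : (0 : ℝ) < n + 1 := by positivity
  have hz0 : (0 : ℝ) ≤ (n + 1) * z := mul_nonneg hn.le hz.1.le
  -- `Fin.ofNat` reduces modulo `n + 1`; for `z < 1` the floor is already below `n + 1`, so nothing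
  -- wraps around.
  have hfl : ⌊(n + 1) * z⌋₊ < n + 1 := by
    rw [Nat.floor_lt hz0]
    push_cast
    exact mul_lt_of_lt_one_right hn hz.2
  have hval : ((Fin.ofNat (n + 1) ⌊(n + 1) * z⌋₊ : Fin (n + 1)) : ℕ) = ⌊(n + 1) * z⌋₊ := by
    simp [Fin.ofNat, Nat.mod_eq_of_lt hfl]
  have hle : (⌊(n + 1) * z⌋₊ : ℝ) / (n + 1) ≤ z := by
    rw [div_le_iff₀ hn, mul_comm z]
    exact Nat.floor_le hz0
  have hlt : z - (⌊(n + 1) * z⌋₊ : ℝ) / (n + 1) ≤ 1 / (n + 1) := by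
    rw [sub_le_iff_le_add, ← add_div, le_div_iff₀ hn, mul_comm z, add_comm 1]
    exact (Nat.lt_floor_add_one _).le
  have hg := grid_mem n (Fin.ofNat (n + 1) ⌊(n + 1) * z⌋₊)
  have key := abs_prim_sub_le f hg (Ioo_subset_Icc_self hz) (by rw [hval]; exact hle)
  rw [h1, Pi.sub_apply, h2, h3]
  refine key.trans (mul_le_mul_of_nonneg_right (Real.sqrt_le_sqrt ?_) (norm_nonneg _))
  rw [hval]
  exact hlt

theorem isCompactOperator_V : IsCompactOperator V := by
  have hlim : Tendsto (fun n : ℕ => (step n).comp (grid n)) atTop (𝓝 V) := by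
    rw [tendsto_iff_norm_sub_tendsto_zero]
    refine squeeze_zero (fun _ => norm_nonneg _) (fun n => ?_)
      (g := fun n : ℕ => √(1 / ((n : ℝ) + 1))) ?_
    · rw [norm_sub_rev]
      exact norm_V_sub_step_le n
    · simpa using tendsto_one_div_add_atTop_nhds_zero_nat.sqrt
  refine isCompactOperator_of_tendsto hlim (Eventually.of_forall fun n => ?_)
  exact (isCompactOperator_of_locallyCompactSpace_dom (grid n)).clm_comp (step n)

theorem isCompactOperator_V₁ : IsCompactOperator V₁ := by
  refine isCompactOperator_V.sub (g := ((innerSL ℝ one).smulRight one : L2I →L[ℝ] L2I)) ?_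
  have h : IsCompactOperator (innerSL ℝ one : L2I →L[ℝ] ℝ) :=
    isCompactOperator_of_locallyCompactSpace_dom _
  exact h.clm_comp (ContinuousLinearMap.toSpanSingleton ℝ one)

/-! ### Contraction semigroups generated by the inverse of a dissipative operator -/

/-- A linear term cannot be dominated by a quadratic one near `τ = 0`. This turns one-sided
quadratic inequalities into orthogonality relations. -/
theorem eq_zero_of_quadratic_bound {a b : ℝ} (h : ∀ τ : ℝ, τ * a ≤ τ ^ 2 * b) : a = 0 := by
  by_contra ha
  have hb : 0 < |b| + 1 := by positivity
  have h1 := h (a / (|b| + 1))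
  have h2 : 0 < a ^ 2 := by positivity
  rw [div_mul_eq_mul_div, div_pow, div_mul_eq_mul_div, div_le_div_iff₀ hb (by positivity)] at h1
  have h3 : a ^ 2 * (|b| + 1) * (|b| + 1 - b) ≤ 0 := by nlinarith
  have h4 : 0 < |b| + 1 - b := by linarith [le_abs_self b]
  have : 0 < a ^ 2 * (|b| + 1) * (|b| + 1 - b) := by positivity
  linarith

section Hilbert

variable {H : Type*} [NormedAddCommGroup H] [InnerProductSpace ℝ H]

theorem antitoneOn_norm_sq_of_inner_nonpos {w w' : ℝ → H}
    (hw : ∀ t, 0 ≤ t → HasDerivWithinAt w (w' t) (Ici 0) t)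
    (hi : ∀ t, 0 ≤ t → inner ℝ (w t) (w' t) ≤ 0) : AntitoneOn (fun t => ‖w t‖ ^ 2) (Ici 0) := by
  have hd : ∀ t, 0 ≤ t →
      HasDerivWithinAt (fun t => ‖w t‖ ^ 2) (2 * inner ℝ (w t) (w' t)) (Ici 0) t :=
    fun t ht => (hw t ht).norm_sq
  refine antitoneOn_of_deriv_nonpos (convex_Ici 0) (fun t ht => (hd t ht).continuousWithinAt)
    (fun t ht => ((hd t (interior_subset ht)).mono interior_subset).differentiableWithinAt)
    fun t ht => ?_
  rw [interior_Ici] at ht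
  rw [((hd t (le_of_lt ht)).hasDerivAt (Ici_mem_nhds ht)).deriv]
  linarith [hi t (le_of_lt ht)]

theorem eq_zero_of_dissipative_flow {w w' : ℝ → H}
    (hw : ∀ t, 0 ≤ t → HasDerivWithinAt w (w' t) (Ici 0) t)
    (hi : ∀ t, 0 ≤ t → inner ℝ (w t) (w' t) ≤ 0) (h0 : w 0 = 0) {t : ℝ} (ht : 0 ≤ t) :
    w t = 0 := by
  have h := antitoneOn_norm_sq_of_inner_nonpos hw hi self_mem_Ici ht ht
  simp only [h0] at h
  have h2 : ‖w t‖ ^ 2 ≤ 0 := by simpa using h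
  exact norm_eq_zero.1 (pow_eq_zero_iff two_ne_zero |>.1 (le_antisymm h2 (by positivity)))

variable {B : H →L[ℝ] H}

/-- If `z` is orthogonal to the range, dissipativity at `z + τ x` has the linear term `τ ⟨B z, x⟩`
only, so `B z = 0` and hence `z = 0`. -/
theorem denseRange_of_dissipative [CompleteSpace H] (hB : ∀ x, inner ℝ (B x) x ≤ 0)
    (hinj : Function.Injective B) : DenseRange B := by
  have h : B.range.topologicalClosure = ⊤ := by
    rw [Submodule.topologicalClosure_eq_top_iff, Submodule.eq_bot_iff]
    intro z hz
    have hz' : ∀ x, inner ℝ (B x) z = 0 := fun x => (Submodule.mem_orthogonal _ z).1 hz _ ⟨x, rfl⟩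
    have h1 : ∀ x, inner ℝ (B z) x = 0 := fun x => by
      refine eq_zero_of_quadratic_bound (b := -inner ℝ (B x) x) fun τ => ?_
      have h2 := hB (z + τ • x)
      simp only [map_add, map_smul, inner_add_left, inner_add_right, real_inner_smul_left,
        real_inner_smul_right, hz'] at h2
      nlinarith
    exact hinj (by rw [map_zero]; exact inner_self_eq_zero.1 (h1 (B z)))
  have h2 := congrArg (fun S : Submodule ℝ H => (S : Set H)) h
  rw [denseRange_iff_closure_range]
  rwa [Submodule.topologicalClosure_coe, Submodule.top_coe, LinearMap.coe_range] at h2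

/-- Lax–Milgram for the coercive operator `ε - B`. With `𝒜 = B⁻¹`, the operator `(B - ε)⁻¹ = 𝒜 (1 -
ε 𝒜)⁻¹` is the Yosida approximant of `𝒜`. -/
theorem exists_resolvent [CompleteSpace H] (hB : ∀ x, inner ℝ (B x) x ≤ 0) {ε : ℝ} (hε : 0 < ε) :
    ∃ A : H →L[ℝ] H, (∀ x, A (B x - ε • x) = x) ∧ ∀ x, B (A x) - ε • A x = x := by
  have hc : IsCoercive ((innerSL ℝ).comp (ε • ContinuousLinearMap.id ℝ H - B)) := by
    refine ⟨ε, hε, fun u => ?_⟩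
    have : inner ℝ (ε • u - B u) u = ε * ‖u‖ * ‖u‖ - inner ℝ (B u) u := by
      rw [inner_sub_left, real_inner_smul_left, real_inner_self_eq_norm_sq]
      ring
    change ε * ‖u‖ * ‖u‖ ≤ inner ℝ (ε • u - B u) u
    linarith [hB u]
  have hE : ∀ x, hc.continuousLinearEquivOfBilin x = ε • x - B x := fun x =>
    ext_inner_right ℝ fun w => by
      rw [hc.continuousLinearEquivOfBilin_apply]
      rfl
  refine ⟨-(hc.continuousLinearEquivOfBilin.symm : H →L[ℝ] H), fun x => ?_, fun x => ?_⟩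
  · have : B x - ε • x = -(hc.continuousLinearEquivOfBilin x) := by rw [hE]; abel
    rw [this]
    simp
  · have := hE (hc.continuousLinearEquivOfBilin.symm x)
    rw [ContinuousLinearEquiv.apply_symm_apply] at this
    simp only [neg_apply, ContinuousLinearEquiv.coe_coe, map_neg, smul_neg]
    nth_rewrite 3 [this]
    abel

/-! ### Yosida approximants -/

section Resolvent

variable {A : H →L[ℝ] H} {ε : ℝ}

theorem yosida_comm (h1 : ∀ x, A (B x - ε • x) = x) (h2 : ∀ x, B (A x) - ε • A x = x) (x : H) :
    A (B x) = B (A x) := by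
  have e1 := h1 x
  have e2 := h2 x
  rw [map_sub, map_smul, sub_eq_iff_eq_add] at e1
  rw [sub_eq_iff_eq_add] at e2
  rw [e1, e2]

theorem yosida_inner_nonpos (hB : ∀ x, inner ℝ (B x) x ≤ 0) (hε : 0 < ε)
    (h2 : ∀ x, B (A x) - ε • A x = x) (x : H) : inner ℝ (A x) x ≤ 0 := by
  nth_rewrite 2 [← h2 x]
  rw [inner_sub_right, real_inner_smul_right, real_inner_comm, real_inner_self_eq_norm_sq]
  nlinarith [hB (A x), sq_nonneg ‖A x‖]

/-- Expanding the square of `x = B A x - ε A x`, the cross term `-2 ε ⟨B A x, A x⟩` is nonnegative,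
so `‖B A x‖ ≤ ‖x‖` uniformly in `ε`. -/
theorem yosida_norm_le (hB : ∀ x, inner ℝ (B x) x ≤ 0) (hε : 0 < ε)
    (h1 : ∀ x, A (B x - ε • x) = x) (h2 : ∀ x, B (A x) - ε • A x = x) (x : H) :
    ‖A (B x)‖ ≤ ‖x‖ := by
  rw [yosida_comm h1 h2]
  refine (sq_le_sq₀ (norm_nonneg _) (norm_nonneg _)).1 ?_
  nth_rewrite 2 [← h2 x]
  rw [@norm_sub_sq_real, real_inner_smul_right, norm_smul, mul_pow]
  have := hB (A x)
  nlinarith [mul_nonneg (sq_nonneg ‖ε‖) (sq_nonneg ‖A x‖)]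

theorem yosida_apply_sub (h1 : ∀ x, A (B x - ε • x) = x) (x : H) :
    A (B x) - x = ε • A x := by
  have e1 := h1 x
  rw [map_sub, map_smul, sub_eq_iff_eq_add] at e1
  rw [e1]
  abel

theorem yosida_commute {A' : H →L[ℝ] H} (h1 : ∀ x, A (B x - ε • x) = x)
    (h2 : ∀ x, B (A x) - ε • A x = x) (hc : ∀ x, A' (B x) = B (A' x)) : Commute A A' := by
  ext x
  change A (A' x) = A' (A x)
  nth_rewrite 1 [← h2 x]
  rw [map_sub, map_smul, hc, h1]

end Resolvent

/-! ### Exponentials of bounded dissipative operators -/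

section Exponential

/-- The semigroup of a bounded operator. -/
def expSemigroup (A : H →L[ℝ] H) (t : ℝ) : H →L[ℝ] H := NormedSpace.exp (t • A)

theorem expSemigroup_zero (A : H →L[ℝ] H) : expSemigroup A 0 = 1 := by
  simp [expSemigroup]

theorem expSemigroup_commute {A A' : H →L[ℝ] H} (h : Commute A A') (t : ℝ) :
    Commute (expSemigroup A t) A' :=
  ((h.symm.smul_right t).exp_right).symm

variable [CompleteSpace H]

theorem expSemigroup_hasDerivAt (A : H →L[ℝ] H) (t : ℝ) :
    HasDerivAt (expSemigroup A) (expSemigroup A t * A) t :=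
  hasDerivAt_exp_smul_const A t

theorem expSemigroup_hasDerivAt_apply (A : H →L[ℝ] H) (t : ℝ) (x : H) :
    HasDerivAt (fun s => expSemigroup A s x) (expSemigroup A t (A x)) t := by
  simpa using (expSemigroup_hasDerivAt A t).clm_apply (hasDerivAt_const t x)

theorem expSemigroup_add (A : H →L[ℝ] H) (s t : ℝ) :
    expSemigroup A (s + t) = expSemigroup A s * expSemigroup A t := by
  let : NormedAlgebra ℚ (H →L[ℝ] H) := NormedAlgebra.restrictScalars ℚ ℝ _
  rw [expSemigroup, add_smul, NormedSpace.exp_add_of_commute]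
  · rfl
  · exact ((Commute.refl A).smul_left s).smul_right t

theorem norm_expSemigroup_le {A : H →L[ℝ] H} (hA : ∀ x, inner ℝ (A x) x ≤ 0) {t : ℝ} (ht : 0 ≤ t)
    (x : H) : ‖expSemigroup A t x‖ ≤ ‖x‖ := by
  have h := antitoneOn_norm_sq_of_inner_nonpos (w := fun s => expSemigroup A s x)
    (fun s _ => (expSemigroup_hasDerivAt_apply A s x).hasDerivWithinAt) (fun s _ => by
      have hc : expSemigroup A s (A x) = A (expSemigroup A s x) :=
        congrArg (fun F : H →L[ℝ] H => F x) (expSemigroup_commute (Commute.refl A) s).eq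
      rw [hc, real_inner_comm]
      exact hA _) self_mem_Ici ht ht
  simp only [expSemigroup_zero] at h
  exact (sq_le_sq₀ (norm_nonneg _) (norm_nonneg _)).1 h

theorem norm_expSemigroup_sub_le {A : H →L[ℝ] H} (hA : ∀ x, inner ℝ (A x) x ≤ 0) {s t : ℝ}
    (hs : 0 ≤ s) (hst : s ≤ t) (x : H) :
    ‖expSemigroup A t x - expSemigroup A s x‖ ≤ ‖A x‖ * (t - s) :=
  norm_image_sub_le_of_norm_deriv_le_segment' (f := fun s => expSemigroup A s x)
    (fun r _ => (expSemigroup_hasDerivAt_apply A r x).hasDerivWithinAt)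
    (fun _ hr => norm_expSemigroup_le hA (hs.trans hr.1) _) t ⟨hst, le_rfl⟩

/-- The path `s ↦ exp((t-s)A) exp(sA') x` joins the two values, and by commutation its derivative is
the contraction `exp((t-s)A) exp(sA')` applied to `A' x - A x`. -/
theorem norm_expSemigroup_sub_expSemigroup_le {A A' : H →L[ℝ] H} (hA : ∀ x, inner ℝ (A x) x ≤ 0)
    (hA' : ∀ x, inner ℝ (A' x) x ≤ 0) (hc : Commute A A') {t : ℝ} (ht : 0 ≤ t) (x : H) :
    ‖expSemigroup A' t x - expSemigroup A t x‖ ≤ ‖A' x - A x‖ * t := by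
  have hd : ∀ s, HasDerivAt (fun s => expSemigroup A (t - s) (expSemigroup A' s x))
      (expSemigroup A (t - s) (expSemigroup A' s (A' x - A x))) s := by
    intro s
    have h1 : HasDerivAt (fun s => expSemigroup A (t - s)) (-(expSemigroup A (t - s) * A)) s := by
      have h0 := (expSemigroup_hasDerivAt A (t - s)).scomp s ((hasDerivAt_id s).const_sub t)
      rw [neg_one_smul] at h0
      exact h0
    have hcc : expSemigroup A' s (A x) = A (expSemigroup A' s x) :=
      congrArg (fun F : H →L[ℝ] H => F x) (expSemigroup_commute hc.symm s).eq
    have h2 := h1.clm_apply (expSemigroup_hasDerivAt_apply A' s x)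
    convert h2 using 1
    rw [map_sub, map_sub, hcc]
    change _ = -expSemigroup A (t - s) (A (expSemigroup A' s x)) + _
    abel
  have h := norm_image_sub_le_of_norm_deriv_le_segment' (a := 0) (b := t)
    (fun r _ => (hd r).hasDerivWithinAt) (C := ‖A' x - A x‖)
    (fun r hr => (norm_expSemigroup_le hA (by linarith [hr.2]) _).trans
      (norm_expSemigroup_le hA' hr.1 _)) t ⟨ht, le_rfl⟩
  simpa [expSemigroup_zero] using h

/-- The bound avoids `‖A‖`, which blows up along the Yosida sequence. It will be used with `x = B (B
g)` and `f = B g`, where `‖A x - f‖` tends to `0` and `‖A f‖ ≤ ‖g‖`. -/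
theorem norm_expSemigroup_sub_sub_le {A : H →L[ℝ] H} (hA : ∀ x, inner ℝ (A x) x ≤ 0) {t : ℝ}
    (ht : 0 ≤ t) (x f : H) :
    ‖expSemigroup A t x - x - t • f‖ ≤ (‖A x - f‖ + ‖A f‖ * t) * t := by
  have hd : ∀ s, HasDerivAt (fun s => expSemigroup A s x - s • f)
      (expSemigroup A s (A x) - f) s := fun s => by
    have h0 := (expSemigroup_hasDerivAt_apply A s x).sub ((hasDerivAt_id s).smul_const f)
    rw [one_smul] at h0
    exact h0
  have h := norm_image_sub_le_of_norm_deriv_le_segment' (a := 0) (b := t)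
    (fun r _ => (hd r).hasDerivWithinAt) (C := ‖A x - f‖ + ‖A f‖ * t) (fun r hr => by
      have e : expSemigroup A r (A x) - f
          = expSemigroup A r (A x - f) + (expSemigroup A r f - expSemigroup A 0 f) := by
        rw [map_sub, expSemigroup_zero]
        simp
      rw [e]
      refine (norm_add_le _ _).trans (add_le_add (norm_expSemigroup_le hA hr.1 _) ?_)
      refine (norm_expSemigroup_sub_le hA le_rfl hr.1 f).trans ?_
      have : r - 0 ≤ t := by linarith [hr.2]
      gcongr) t ⟨ht, le_rfl⟩
  have e : expSemigroup A t x - x - t • f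
      = expSemigroup A t x - t • f - (expSemigroup A 0 x - (0 : ℝ) • f) := by
    rw [expSemigroup_zero]
    simp only [one_apply_eq_self, zero_smul, sub_zero]
    abel
  rw [e]
  simpa using h

end Exponential

end Hilbert

/-! ### Real functions with constant derivative on the half-line -/

theorem eq_add_mul_of_hasDerivWithinAt {g : ℝ → ℝ} {c : ℝ}
    (hg : ∀ t, 0 ≤ t → HasDerivWithinAt g c (Ici 0) t) {t : ℝ} (ht : 0 ≤ t) :
    g t = g 0 + t * c := by
  have h2 : ∀ s ∈ Icc 0 t, HasDerivWithinAt (fun s : ℝ => g s - s * c) 0 (Icc 0 t) s := by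
    intro s hs
    have h3 := (hg s hs.1).sub ((hasDerivWithinAt_id s _).mul_const c)
    rw [one_mul, sub_self] at h3
    exact h3.mono Icc_subset_Ici_self
  have h4 := norm_image_sub_le_of_norm_deriv_le_segment' h2 (C := 0) (fun _ _ => by simp) t
    ⟨ht, le_rfl⟩
  rw [zero_mul, zero_mul, sub_zero] at h4
  linarith [norm_le_zero_iff.1 h4]

theorem deriv_eq_zero_of_bounded {g : ℝ → ℝ} {c M : ℝ}
    (hg : ∀ t, 0 ≤ t → HasDerivWithinAt g c (Ici 0) t) (hM : ∀ t, 0 ≤ t → |g t| ≤ M) : c = 0 := by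
  by_contra hc
  have hc' : 0 < |c| := abs_pos.2 hc
  have hM0 : 0 ≤ M := (abs_nonneg _).trans (hM 0 le_rfl)
  -- By this time `g` would have moved by `2 M + 1`, more than the bound `M` permits.
  have ht : 0 ≤ (2 * M + 1) / |c| := by positivity
  have h1 : |(2 * M + 1) / |c| * c| = 2 * M + 1 := by
    rw [abs_mul, abs_of_nonneg ht, div_mul_cancel₀ _ hc'.ne']
  have h2 : (2 * M + 1) / |c| * c = g ((2 * M + 1) / |c|) - g 0 := by
    rw [eq_add_mul_of_hasDerivWithinAt hg ht]
    ring
  rw [h2] at h1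
  have h3 := abs_sub (g ((2 * M + 1) / |c|)) (g 0)
  linarith [hM _ ht, hM 0 le_rfl]

/-! ### The semigroup generated by the inverse of a bounded dissipative operator -/

section Hilbert

variable {H : Type*} [NormedAddCommGroup H] [InnerProductSpace ℝ H]

/-- `T` is a strongly continuous contraction semigroup whose generator has the bounded
inverse `B`. -/
structure IsInverseGenerated (B : H →L[ℝ] H) (T : ℝ≥0 → H →L[ℝ] H) : Prop where
  isC0 : IsC0Semigroup T
  norm_le : ∀ t x, ‖T t x‖ ≤ ‖x‖
  commute : ∀ t x, T t (B x) = B (T t x)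
  isLittleO : ∀ x, ∀ c > 0, ∃ δ > 0, ∀ t : ℝ≥0, (t : ℝ) < δ →
    ‖T t (B x) - B x - (t : ℝ) • x‖ ≤ c * t

theorem exists_yosida_sequence [CompleteSpace H] {B : H →L[ℝ] H}
    (hB : ∀ x, inner ℝ (B x) x ≤ 0) (hinj : Function.Injective B) :
    ∃ A : ℕ → H →L[ℝ] H, (∀ n x, inner ℝ (A n x) x ≤ 0) ∧ (∀ m n, Commute (A m) (A n)) ∧
      (∀ n, Commute (A n) B) ∧ (∀ n x, ‖A n (B x)‖ ≤ ‖x‖) ∧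
      ∀ x, Tendsto (fun n => A n (B x)) atTop (𝓝 x) := by
  have hε : ∀ n : ℕ, (0 : ℝ) < 1 / ((n : ℝ) + 1) := fun n => by positivity
  choose A h1 h2 using fun n => exists_resolvent hB (hε n)
  have hcomm : ∀ n x, A n (B x) = B (A n x) := fun n => yosida_comm (h1 n) (h2 n)
  have hle : ∀ n x, ‖A n (B x)‖ ≤ ‖x‖ := fun n => yosida_norm_le hB (hε n) (h1 n) (h2 n)
  refine ⟨A, fun n => yosida_inner_nonpos hB (hε n) (h2 n),
    fun m n => yosida_commute (h1 m) (h2 m) (hcomm n), fun n => ContinuousLinearMap.ext (hcomm n),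
    hle, fun x => ?_⟩
  rw [Metric.tendsto_atTop]
  intro η hη
  obtain ⟨g, hg⟩ := (denseRange_of_dissipative hB hinj).exists_dist_lt x
    (show 0 < η / 3 by positivity)
  obtain ⟨N, hN⟩ := (Metric.tendsto_atTop.1 ((tendsto_one_div_add_atTop_nhds_zero_nat
    (𝕜 := ℝ)).mul_const ‖g‖)) (η / 3) (by positivity)
  refine ⟨N, fun n hn => ?_⟩
  -- On the range of `B` the error is `A (B (B g)) - B g = ε A (B g)`, of norm at most `ε ‖g‖`; the
  -- uniform bound on `A n ∘ B` extends the convergence by density.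
  have h3 : A n (B x) - x = A n (B (x - B g)) - (x - B g) + (1 / ((n : ℝ) + 1)) • A n (B g) := by
    rw [← yosida_apply_sub (h1 n) (B g)]
    simp only [map_sub]
    abel
  have h4 := hN n hn
  rw [zero_mul, Real.dist_eq, sub_zero] at h4
  rw [dist_eq_norm] at hg ⊢
  rw [h3]
  calc _ ≤ ‖A n (B (x - B g))‖ + ‖x - B g‖ + ‖(1 / ((n : ℝ) + 1)) • A n (B g)‖ :=
        (norm_add_le _ _).trans (add_le_add_left (norm_sub_le _ _) _)
    _ ≤ ‖x - B g‖ + ‖x - B g‖ + (1 / ((n : ℝ) + 1)) * ‖g‖ := by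
        rw [norm_smul, Real.norm_of_nonneg (hε n).le]
        gcongr
        · exact hle n _
        · exact hle n _
    _ < η := by linarith [le_abs_self (1 / ((n : ℝ) + 1) * ‖g‖)]

/-- Hille–Yosida through the inverse. On vectors `B y` the exponentials are Cauchy because `A n (B
y)` converges; contractivity carries this over to the closure of the range, which is everything. -/
theorem exists_isInverseGenerated [CompleteSpace H] {B : H →L[ℝ] H}
    (hB : ∀ x, inner ℝ (B x) x ≤ 0) (hinj : Function.Injective B) :
    ∃ T, IsInverseGenerated B T := by
  obtain ⟨A, hA, hAA, hAB, hle, hlim⟩ := exists_yosida_sequence hB hinj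
  have hdense := denseRange_of_dissipative hB hinj
  have hcauchy : ∀ (t : ℝ≥0) x, CauchySeq fun n => expSemigroup (A n) t x := by
    intro t x
    rw [Metric.cauchySeq_iff]
    intro η hη
    obtain ⟨y, hy⟩ := hdense.exists_dist_lt x (show 0 < η / 3 by positivity)
    obtain ⟨N, hN⟩ := Metric.cauchySeq_iff.1 (hlim y).cauchySeq (η / (3 * (t + 1)))
      (by positivity)
    refine ⟨N, fun m hm n hn => ?_⟩
    have h1 := hN m hm n hn
    rw [dist_eq_norm, lt_div_iff₀ (by positivity)] at h1
    have h2 := norm_expSemigroup_sub_expSemigroup_le (hA n) (hA m) (hAA n m) t.2 (B y)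
    have h3 := norm_expSemigroup_le (hA m) t.2 (x - B y)
    have h4 := norm_expSemigroup_le (hA n) t.2 (x - B y)
    have h5 : expSemigroup (A m) t x - expSemigroup (A n) t x
        = expSemigroup (A m) t (x - B y) - expSemigroup (A n) t (x - B y)
          + (expSemigroup (A m) t (B y) - expSemigroup (A n) t (B y)) := by
      simp only [map_sub]
      abel
    rw [dist_eq_norm] at hy ⊢
    rw [h5]
    refine (norm_add_le _ _).trans_lt ?_
    have h6 := norm_sub_le (expSemigroup (A m) t (x - B y)) (expSemigroup (A n) t (x - B y))
    have h7 : ‖A m (B y) - A n (B y)‖ * t * 3 ≤ ‖A m (B y) - A n (B y)‖ * (3 * (t + 1)) := by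
      nlinarith [norm_nonneg (A m (B y) - A n (B y))]
    change ‖expSemigroup (A m) t (x - B y)‖ ≤ _ at h3
    change ‖expSemigroup (A n) t (x - B y)‖ ≤ _ at h4
    change ‖expSemigroup (A m) t (B y) - expSemigroup (A n) t (B y)‖ ≤ _ * (t : ℝ) at h2
    linarith
  choose S hS using fun t x => cauchySeq_tendsto_of_complete (hcauchy t x)
  let T : ℝ≥0 → H →L[ℝ] H := fun t =>
    continuousLinearMapOfTendsto (fun n => expSemigroup (A n) t) (tendsto_pi_nhds.2 (hS t))
  have hT : ∀ (t : ℝ≥0) x, Tendsto (fun n => expSemigroup (A n) t x) atTop (𝓝 (T t x)) := hS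
  have hTle : ∀ t x, ‖T t x‖ ≤ ‖x‖ := fun t x =>
    le_of_tendsto (hT t x).norm (Eventually.of_forall fun n => norm_expSemigroup_le (hA n) t.2 x)
  have hlip : ∀ (s t : ℝ≥0) x, s ≤ t → ‖T t (B x) - T s (B x)‖ ≤ ‖x‖ * (t - s) := by
    intro s t x hst
    refine le_of_tendsto ((hT t _).sub (hT s _)).norm (Eventually.of_forall fun n => ?_)
    refine (norm_expSemigroup_sub_le (hA n) s.2 (NNReal.coe_le_coe.2 hst) (B x)).trans ?_
    exact mul_le_mul_of_nonneg_right (hle n x) (sub_nonneg.2 (NNReal.coe_le_coe.2 hst))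
  have hlip' : ∀ x, LipschitzWith ‖x‖₊ fun t => T t (B x) := fun x =>
    LipschitzWith.of_dist_le_mul fun t s => by
      rw [dist_eq_norm, NNReal.dist_eq, coe_nnnorm]
      rcases le_total s t with h | h
      · rw [abs_of_nonneg (sub_nonneg.2 (NNReal.coe_le_coe.2 h))]
        exact hlip s t x h
      · rw [norm_sub_rev, abs_sub_comm, abs_of_nonneg (sub_nonneg.2 (NNReal.coe_le_coe.2 h))]
        exact hlip t s x h
  refine ⟨T, ⟨?_, ?_, ?_⟩, hTle, ?_, ?_⟩
  · ext x
    refine tendsto_nhds_unique (hT 0 x) ?_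
    simp [expSemigroup_zero]
  · intro s t
    ext x
    refine tendsto_nhds_unique (hT (s + t) x) ?_
    have h1 : Tendsto (fun n => expSemigroup (A n) s (expSemigroup (A n) t x - T t x)) atTop
        (𝓝 0) := by
      refine squeeze_zero_norm (fun n => norm_expSemigroup_le (hA n) s.2 _) ?_
      simpa using ((hT t x).sub_const (T t x)).norm
    have h2 := h1.add (hT s (T t x))
    rw [zero_add] at h2
    refine h2.congr fun n => ?_
    rw [map_sub, sub_add_cancel, NNReal.coe_add, expSemigroup_add]
    rfl
  · intro x
    -- Every orbit is a uniform limit of orbits starting in the range of `B`, and those are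
    -- Lipschitz.
    refine continuous_of_uniform_approx_of_continuous fun u hu => ?_
    obtain ⟨η, hη, hηu⟩ := Metric.mem_uniformity_dist.1 hu
    obtain ⟨y, hy⟩ := hdense.exists_dist_lt x hη
    refine ⟨fun t => T t (B y), (hlip' y).continuous, fun t => hηu ?_⟩
    rw [dist_eq_norm, ← map_sub]
    rw [dist_eq_norm] at hy
    exact (hTle t _).trans_lt hy
  · intro t x
    refine tendsto_nhds_unique (hT t (B x)) ?_
    refine ((B.continuous.tendsto _).comp (hT t x)).congr fun n => ?_
    exact congrArg (fun F : H →L[ℝ] H => F x) (expSemigroup_commute (hAB n) t).eq.symm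
  · intro x c hc
    -- Replacing `x` by `B g` costs `c/4` in the orbit term and `c/4` in the linear term; at `B (B
    -- g)` the Taylor remainder is at most `‖g‖ t²`, and `δ` makes it at most `(c/2) t`.
    obtain ⟨g, hg⟩ := hdense.exists_dist_lt x (show 0 < c / 4 by positivity)
    refine ⟨c / (2 * (‖g‖ + 1)), by positivity, fun t ht => ?_⟩
    have h1 : ‖T t (B (B g)) - B (B g) - (t : ℝ) • B g‖ ≤ (0 + ‖g‖ * t) * t := by
      have hl := (((hlim (B g)).sub_const (B g)).norm.add_const (‖g‖ * t)).mul_const (t : ℝ)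
      rw [sub_self, norm_zero] at hl
      refine le_of_tendsto_of_tendsto (((hT t _).sub_const _).sub_const _).norm hl
        (Eventually.of_forall fun n => ?_)
      refine (norm_expSemigroup_sub_sub_le (hA n) t.2 (B (B g)) (B g)).trans ?_
      have := hle n g
      have ht0 : (0 : ℝ) ≤ t := t.2
      exact mul_le_mul_of_nonneg_right
        (add_le_add le_rfl (mul_le_mul_of_nonneg_right this ht0)) ht0
    have h2 := hlip 0 t (x - B g) bot_le
    have h0 : T 0 (B (x - B g)) = B (x - B g) := by
      refine tendsto_nhds_unique (hT 0 _) ?_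
      simp [expSemigroup_zero]
    rw [h0, NNReal.coe_zero, sub_zero] at h2
    have h3 : T t (B x) - B x - (t : ℝ) • x
        = (T t (B (B g)) - B (B g) - (t : ℝ) • B g)
          + (T t (B (x - B g)) - B (x - B g)) - (t : ℝ) • (x - B g) := by
      simp only [map_sub, smul_sub]
      abel
    rw [h3]
    refine (norm_sub_le _ _).trans ((add_le_add_left (norm_add_le _ _) _).trans ?_)
    rw [norm_smul, Real.norm_of_nonneg (NNReal.coe_nonneg t)]
    rw [dist_eq_norm] at hg
    rw [lt_div_iff₀ (by positivity)] at ht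
    have ht0 : (0 : ℝ) ≤ t := t.2
    have h4 : ‖x - B g‖ * t ≤ c / 4 * t := mul_le_mul_of_nonneg_right hg.le ht0
    have h5 : ‖g‖ * t * t ≤ c / 2 * t := by
      refine mul_le_mul_of_nonneg_right ?_ ht0
      nlinarith
    linarith

/-! ### Generator, norm-preserving orbits and decay -/

namespace IsInverseGenerated

variable {B : H →L[ℝ] H} {T : ℝ≥0 → H →L[ℝ] H}

theorem map_zero_apply (h : IsInverseGenerated B T) (x : H) : T 0 x = x := by
  rw [h.isC0.map_zero]
  rfl

theorem map_add_apply (h : IsInverseGenerated B T) (s t : ℝ≥0) (x : H) :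
    T (s + t) x = T s (T t x) := by
  rw [h.isC0.map_add]
  rfl

theorem tendsto_slope (h : IsInverseGenerated B T) (x : H) :
    Tendsto (fun t : ℝ≥0 => (t : ℝ)⁻¹ • (T t (B x) - B x)) (𝓝[>] 0) (𝓝 x) := by
  rw [Metric.tendsto_nhdsWithin_nhds]
  intro η hη
  obtain ⟨δ, hδ, H'⟩ := h.isLittleO x (η / 2) (by positivity)
  refine ⟨δ, hδ, fun t ht hd => ?_⟩
  have ht' : (0 : ℝ) < t := ht
  rw [NNReal.dist_eq, NNReal.coe_zero, sub_zero, abs_of_pos ht'] at hd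
  have h1 := H' t hd
  have h2 : (t : ℝ)⁻¹ • (T t (B x) - B x) - x
      = (t : ℝ)⁻¹ • (T t (B x) - B x - (t : ℝ) • x) := by
    rw [smul_sub _ _ ((t : ℝ) • x), inv_smul_smul₀ ht'.ne']
  rw [dist_eq_norm, h2, norm_smul, norm_inv, Real.norm_of_nonneg ht'.le]
  calc _ ≤ (t : ℝ)⁻¹ * (η / 2 * t) := by gcongr
    _ = η / 2 := by field_simp
    _ < η := by linarith

/-- Applying `B` to the difference quotients at `x` gives those at `B x`, which converge to `x`;
continuity of `B` gives the limit `B y`. So the generator is exactly `B⁻¹`, with no larger domain.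
-/
theorem tendsto_slope_iff (h : IsInverseGenerated B T) (x y : H) :
    Tendsto (fun t : ℝ≥0 => (t : ℝ)⁻¹ • (T t x - x)) (𝓝[>] 0) (𝓝 y) ↔ x = B y := by
  refine ⟨fun hy => ?_, fun hxy => hxy ▸ h.tendsto_slope y⟩
  refine tendsto_nhds_unique (h.tendsto_slope x) ?_
  refine ((B.continuous.tendsto y).comp hy).congr fun t => ?_
  simp [h.commute]

theorem hasDerivWithinAt (h : IsInverseGenerated B T) (x : H) {t : ℝ} (ht : 0 ≤ t) :
    HasDerivWithinAt (fun s : ℝ => T s.toNNReal (B x)) (T t.toNNReal x) (Ici 0) t := by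
  rw [hasDerivWithinAt_iff_isLittleO, Asymptotics.isLittleO_iff]
  intro c hc
  obtain ⟨δ, hδ, H'⟩ := h.isLittleO x (c / 2) (by positivity)
  have hcont := (h.isC0.strongly_continuous x).tendsto 0
  rw [h.map_zero_apply, Metric.tendsto_nhds_nhds] at hcont
  obtain ⟨δ', hδ', H''⟩ := hcont (c / 2) (by positivity)
  filter_upwards [self_mem_nhdsWithin,
    mem_nhdsWithin_of_mem_nhds (Metric.ball_mem_nhds t (lt_min hδ hδ'))] with s hs hst
  rw [Metric.mem_ball, Real.dist_eq, lt_min_iff] at hst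
  have hs' : 0 ≤ s := hs
  have key : ∀ r : ℝ≥0, (r : ℝ) = |s - t| → ‖T r (B x) - B x - (r : ℝ) • x‖ ≤ c / 2 * |s - t| ∧
      ‖T r x - x‖ ≤ c / 2 := by
    intro r hr
    refine ⟨by simpa [hr] using H' r (by rw [hr]; exact hst.1), ?_⟩
    rw [← dist_eq_norm]
    refine (H'' ?_).le
    rw [NNReal.dist_eq, NNReal.coe_zero, sub_zero, NNReal.abs_eq, hr]
    exact hst.2
  rw [Real.norm_eq_abs]
  rcases le_total t s with hts | hts
  · obtain ⟨h1, -⟩ := key (s - t).toNNReal (by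
      rw [Real.coe_toNNReal _ (sub_nonneg.2 hts), abs_of_nonneg (sub_nonneg.2 hts)])
    have e : s.toNNReal = t.toNNReal + (s - t).toNNReal := by
      rw [← Real.toNNReal_add ht (sub_nonneg.2 hts)]
      congr 1
      ring
    have e2 : T s.toNNReal (B x) - T t.toNNReal (B x) - (s - t) • T t.toNNReal x
        = T t.toNNReal (T (s - t).toNNReal (B x) - B x - (((s - t).toNNReal : ℝ≥0) : ℝ) • x) := by
      rw [Real.coe_toNNReal _ (sub_nonneg.2 hts), e, h.map_add_apply, map_sub, map_sub, map_smul]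
    rw [e2]
    refine (h.norm_le _ _).trans (h1.trans ?_)
    nlinarith [abs_nonneg (s - t)]
  -- To the left of `t` only `T s` can be factored out, so the candidate derivative `T t x` must be
  -- compared with `T s x`; strong continuity at `0` controls that extra term.
  · obtain ⟨h1, h2⟩ := key (t - s).toNNReal (by
      rw [Real.coe_toNNReal _ (sub_nonneg.2 hts), abs_sub_comm,
        abs_of_nonneg (sub_nonneg.2 hts)])
    have e : t.toNNReal = s.toNNReal + (t - s).toNNReal := by
      rw [← Real.toNNReal_add hs' (sub_nonneg.2 hts)]
      congr 1
      ring
    have e2 : T s.toNNReal (B x) - T t.toNNReal (B x) - (s - t) • T t.toNNReal x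
        = T s.toNNReal ((t - s) • (T (t - s).toNNReal x - x)
          - (T (t - s).toNNReal (B x) - B x - (((t - s).toNNReal : ℝ≥0) : ℝ) • x)) := by
      rw [Real.coe_toNNReal _ (sub_nonneg.2 hts), e, h.map_add_apply, h.map_add_apply]
      simp only [map_sub, map_smul]
      module
    rw [e2]
    refine (h.norm_le _ _).trans ((norm_sub_le _ _).trans ?_)
    rw [norm_smul, Real.norm_of_nonneg (sub_nonneg.2 hts)]
    have h3 : (t - s) * ‖T (t - s).toNNReal x - x‖ ≤ |s - t| * (c / 2) := by
      rw [abs_sub_comm, abs_of_nonneg (sub_nonneg.2 hts)]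
      exact mul_le_mul_of_nonneg_left h2 (sub_nonneg.2 hts)
    linarith

/-- Contractivity at `y + τ z`: since the norm of `y` is preserved, the zeroth-order terms cancel
and the term linear in `τ` must vanish. -/
theorem isometric_inner (h : IsInverseGenerated B T) {y : H} {t : ℝ≥0} (hy : ‖T t y‖ = ‖y‖)
    (z : H) : inner ℝ (T t y) (T t z) = inner ℝ y z := by
  refine sub_eq_zero.1 (eq_zero_of_quadratic_bound (b := (‖z‖ ^ 2 - ‖T t z‖ ^ 2) / 2) fun τ => ?_)
  have h1 := pow_le_pow_left₀ (norm_nonneg _) (h.norm_le t (y + τ • z)) 2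
  rw [map_add, map_smul, @norm_add_sq_real, @norm_add_sq_real, hy, real_inner_smul_right,
    real_inner_smul_right, norm_smul, norm_smul, mul_pow, mul_pow, Real.norm_eq_abs, sq_abs] at h1
  linarith

theorem isometric_map (h : IsInverseGenerated B T) {y : H} (hy : ∀ t, ‖T t y‖ = ‖y‖) (s : ℝ≥0)
    (t : ℝ≥0) : ‖T t (T s y)‖ = ‖T s y‖ := by
  rw [← h.map_add_apply, hy, hy]

/-- `‖T t (B y)‖²` has derivative `2 ⟨T t (B y), T t y⟩ = 2 ⟨B y, y⟩`, a constant. Being bounded,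
the function forces this constant to be zero. -/
theorem isometric_inverse (h : IsInverseGenerated B T) {y : H} (hy : ∀ t, ‖T t y‖ = ‖y‖) :
    inner ℝ (B y) y = 0 ∧ ∀ t, ‖T t (B y)‖ = ‖B y‖ := by
  have hd : ∀ t : ℝ, 0 ≤ t → HasDerivWithinAt (fun s : ℝ => ‖T s.toNNReal (B y)‖ ^ 2)
      (2 * inner ℝ (B y) y) (Ici 0) t := fun t ht => by
    have h1 := (h.hasDerivWithinAt y ht).norm_sq
    rwa [real_inner_comm, h.isometric_inner (hy _), real_inner_comm] at h1
  have h0 : inner ℝ (B y) y = 0 := by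
    have h1 := deriv_eq_zero_of_bounded hd (M := ‖B y‖ ^ 2) fun t _ => by
      rw [abs_of_nonneg (sq_nonneg _)]
      exact pow_le_pow_left₀ (norm_nonneg _) (h.norm_le _ _) 2
    linarith
  refine ⟨h0, fun t => ?_⟩
  have h6 := eq_add_mul_of_hasDerivWithinAt hd t.2
  rw [h0, mul_zero, mul_zero, add_zero, Real.toNNReal_zero, h.map_zero_apply] at h6
  change ‖T (t : ℝ).toNNReal (B y)‖ ^ 2 = _ at h6
  rw [Real.toNNReal_coe] at h6
  exact (pow_left_inj₀ (norm_nonneg _) (norm_nonneg _) two_ne_zero).1 h6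

theorem antitone_norm (h : IsInverseGenerated B T) (x : H) : Antitone fun t => ‖T t x‖ := by
  intro s t hst
  obtain ⟨r, rfl⟩ := exists_add_of_le hst
  simp only [add_comm s r, h.map_add_apply]
  exact h.norm_le _ _

/-- LaSalle's principle: along an orbit the norm decreases to a limit, and every cluster point keeps
that norm for all times, so `hN` makes the limit `0`. -/
theorem tendsto_norm_zero (h : IsInverseGenerated B T) (hd : DenseRange B)
    (hc : IsCompactOperator B) (hN : ∀ y, (∀ t, ‖T t y‖ = ‖y‖) → y = 0) (x : H) :
    Tendsto (fun t => ‖T t x‖) atTop (𝓝 0) := by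
  have hrange : ∀ x, Tendsto (fun t => ‖T t (B x)‖) atTop (𝓝 0) := by
    intro x
    have hlim := tendsto_atTop_ciInf (h.antitone_norm (B x))
      ⟨0, by rintro _ ⟨t, rfl⟩; exact norm_nonneg _⟩
    obtain ⟨K, hK, hsub⟩ := IsCompactOperator.image_closedBall_subset_compact
      (f := (B : H →ₗ[ℝ] H)) hc ‖x‖
    -- The orbit of `B x` is `B (T t x)`, which stays in the image under `B` of a ball, hence in the
    -- compact set `K`.
    obtain ⟨y, -, φ, hφ, hy⟩ := hK.tendsto_subseq (x := fun n : ℕ => T (n : ℝ≥0) (B x)) fun n => by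
      refine hsub ⟨T n x, by simpa using h.norm_le n x, (h.commute _ _).symm⟩
    have hcast : Tendsto (fun n : ℕ => ((φ n : ℕ) : ℝ≥0)) atTop atTop :=
      tendsto_natCast_atTop_atTop.comp hφ.tendsto_atTop
    have hTy : ∀ s, ‖T s y‖ = ⨅ t, ‖T t (B x)‖ := fun s => by
      refine tendsto_nhds_unique (((T s).continuous.tendsto y).comp hy).norm ?_
      refine (hlim.comp (tendsto_atTop_mono (fun n => le_add_self) hcast : Tendsto (fun n => s + _) _ _)).congr fun n => ?_
      simp only [Function.comp_apply]
      rw [h.map_add_apply]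
    have hy0 : y = 0 := hN y fun t => by
      rw [hTy t, ← hTy 0, h.map_zero_apply]
    have h0 := hTy 0
    rw [hy0, map_zero, norm_zero] at h0
    rwa [← h0] at hlim
  rw [Metric.tendsto_atTop]
  intro η hη
  obtain ⟨y, hy⟩ := hd.exists_dist_lt x (show 0 < η / 2 by positivity)
  obtain ⟨N, hN'⟩ := Metric.tendsto_atTop.1 (hrange y) (η / 2) (by positivity)
  refine ⟨N, fun t ht => ?_⟩
  have h1 := hN' t ht
  rw [Real.dist_eq, sub_zero, abs_of_nonneg (norm_nonneg _)] at h1 ⊢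
  rw [dist_eq_norm] at hy
  have h2 : T t x = T t (x - B y) + T t (B y) := by rw [map_sub, sub_add_cancel]
  rw [h2]
  refine (norm_add_le _ _).trans_lt ?_
  linarith [h.norm_le t (x - B y)]

end IsInverseGenerated

end Hilbert

/-! ### The energy space and the inverse of the closed-loop operator -/

theorem isCompactOperator_pi {E ι : Type*} {F : ι → Type*} [Finite ι] [Zero E] [TopologicalSpace E]
    [∀ i, TopologicalSpace (F i)] {f : ∀ i, E → F i} (hf : ∀ i, IsCompactOperator (f i)) :
    IsCompactOperator fun x i => f i x := by
  choose K hK hf using hf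
  refine ⟨Set.univ.pi K, isCompact_univ_pi hK, ?_⟩
  have : (fun x i => f i x) ⁻¹' Set.univ.pi K = ⋂ i, f i ⁻¹' K i := by
    ext x
    simp
  rw [this]
  exact Filter.iInter_mem.2 hf

/-! ### Positivity of the material constants -/

namespace Composite

variable (P : Composite)

theorem Ap_pos : 0 < P.Ap := by
  have := P.gb_pos
  have := sub_pos.2 P.h₁_lt_h₂
  unfold Ap
  positivity

theorem As_pos : 0 < P.As := by
  have := P.gb_pos
  have := P.h₁_pos
  unfold As
  rw [sub_neg_eq_add]
  positivity

theorem Is_pos : 0 < P.Is := by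
  have := P.gb_pos
  have := P.h₁_pos
  have : P.Is = 4 / 3 * P.gb * P.h₁ ^ 3 := by
    unfold Is
    ring
  rw [this]
  positivity

/-- The height of the center line of the piezoelectric layer. -/
def mid : ℝ := (P.h₁ + P.h₂) / 2

/-- Second moment of the cross-section of the piezoelectric layer about its center line. -/
def Jp : ℝ := P.gb * (P.h₂ - P.h₁) ^ 3 / 6

theorem mid_pos : 0 < P.mid := by
  have := P.h₁_pos
  have := P.h₁_pos.trans P.h₁_lt_h₂
  unfold mid
  positivity

theorem Jp_pos : 0 < P.Jp := by
  have := P.gb_pos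
  have := sub_pos.2 P.h₁_lt_h₂
  unfold Jp
  positivity

theorem I0_eq : P.I0 = P.mid * P.Ap := by
  unfold I0 mid Ap
  ring

/-- The parallel axis theorem. It makes both determinants below visibly positive: the negative
square cancels and only products of positive constants remain. -/
theorem Ip_eq : P.Ip = P.mid ^ 2 * P.Ap + P.Jp := by
  unfold Ip mid Ap Jp
  ring

theorem ρA_pos : 0 < P.ρA :=
  add_pos (mul_pos P.ρp_pos P.Ap_pos) (mul_pos P.ρs_pos P.As_pos)

theorem CA_pos : 0 < P.CA :=
  add_pos (mul_pos P.Cp_pos P.Ap_pos) (mul_pos P.Cs_pos P.As_pos)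

theorem GA_pos : 0 < P.GA :=
  add_pos (mul_pos P.Gs_pos P.As_pos) (mul_pos P.Gp_pos P.Ap_pos)

theorem ρdet_pos : 0 < P.ρA * P.ρI - P.ρI0 ^ 2 := by
  have := P.ρp_pos
  have := P.ρs_pos
  have := P.Ap_pos
  have := P.As_pos
  have := P.Is_pos
  have := P.Jp_pos
  have : P.ρA * P.ρI - P.ρI0 ^ 2 = P.ρp * P.Ap * (P.ρp * P.Jp + P.ρs * P.Is)
      + P.ρs * P.As * (P.ρp * (P.mid ^ 2 * P.Ap + P.Jp) + P.ρs * P.Is) := by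
    rw [ρA, ρI, ρI0, Ip_eq, I0_eq]
    ring
  rw [this]
  positivity

theorem Cdet_pos : 0 < P.CA * P.CI - P.CI0 ^ 2 := by
  have := P.Cp_pos
  have := P.Cs_pos
  have := P.Ap_pos
  have := P.As_pos
  have := P.Is_pos
  have := P.Jp_pos
  have : P.CA * P.CI - P.CI0 ^ 2 = P.Cp * P.Ap * (P.Cp * P.Jp + P.Cs * P.Is)
      + P.Cs * P.As * (P.Cp * (P.mid ^ 2 * P.Ap + P.Jp) + P.Cs * P.Is) := by
    rw [CA, CI, CI0, Ip_eq, I0_eq]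
    ring
  rw [this]
  positivity

/-- The state with the given velocities `v̇, φ̇, ẇ, Φ̇` and strains `v', φ', θ, Φ'`. -/
def ofPhysical (v f w e a b c d : L2I) : State :=
  WithLp.toLp 2 ![a, b, c, d, P.ρA • v - P.ρI0 • f, P.ρI • f - P.ρI0 • v, P.ρA • w,
    (P.eps * P.Ap) • e + P.gam • (P.Ap • a - P.I0 • b)]

theorem vDot_apply (x : State) : P.vDot x = (P.ρI / (P.ρA * P.ρI - P.ρI0 ^ 2)) • x 4
    + (P.ρI0 / (P.ρA * P.ρI - P.ρI0 ^ 2)) • x 5 := rfl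

theorem φDot_apply (x : State) : P.φDot x = (P.ρI0 / (P.ρA * P.ρI - P.ρI0 ^ 2)) • x 4
    + (P.ρA / (P.ρA * P.ρI - P.ρI0 ^ 2)) • x 5 := rfl

theorem wDot_apply (x : State) : P.wDot x = (1 / P.ρA) • x 6 := rfl

theorem ΦDot_apply (x : State) : P.ΦDot x = (1 / (P.eps * P.Ap)) • x 7 - (P.gam / P.eps) • x 0
    + (P.gam * P.I0 / (P.eps * P.Ap)) • x 1 := rfl

theorem axialForce_apply (x : State) :
    P.axialForce x = P.CA • x 0 - P.CI0 • x 1 - (P.gam * P.Ap) • P.ΦDot x := rfl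

theorem bendingMoment_apply (x : State) :
    P.bendingMoment x = P.CI • x 1 - P.CI0 • x 0 + (P.gam * P.I0) • P.ΦDot x := rfl

section ofPhysical

variable (v f w e a b c d : L2I)

theorem vDot_ofPhysical : P.vDot (P.ofPhysical v f w e a b c d) = v := by
  have := P.ρdet_pos.ne'
  have : P.ρI * P.ρA - P.ρI0 ^ 2 ≠ 0 := by rwa [mul_comm]
  change (_ : ℝ) • (P.ρA • v - P.ρI0 • f) + (_ : ℝ) • (P.ρI • f - P.ρI0 • v) = v
  match_scalars <;> field_simp <;> ring

theorem φDot_ofPhysical : P.φDot (P.ofPhysical v f w e a b c d) = f := by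
  have := P.ρdet_pos.ne'
  change (_ : ℝ) • (P.ρA • v - P.ρI0 • f) + (_ : ℝ) • (P.ρI • f - P.ρI0 • v) = f
  match_scalars <;> field_simp <;> ring

theorem wDot_ofPhysical : P.wDot (P.ofPhysical v f w e a b c d) = w := by
  have := P.ρA_pos.ne'
  change (_ : ℝ) • P.ρA • w = w
  match_scalars
  field_simp

theorem ΦDot_ofPhysical : P.ΦDot (P.ofPhysical v f w e a b c d) = e := by
  have := P.Ap_pos.ne'
  have := P.eps_pos.ne'
  change (_ : ℝ) • ((P.eps * P.Ap) • e + P.gam • (P.Ap • a - P.I0 • b)) - (_ : ℝ) • a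
    + (_ : ℝ) • b = e
  match_scalars <;> field_simp <;> ring

end ofPhysical

theorem four_eq (x : State) : P.ρA • P.vDot x - P.ρI0 • P.φDot x = x 4 := by
  have := P.ρdet_pos.ne'
  rw [vDot_apply, φDot_apply]
  match_scalars <;> field_simp
  ring

theorem five_eq (x : State) : P.ρI • P.φDot x - P.ρI0 • P.vDot x = x 5 := by
  have := P.ρdet_pos.ne'
  have : P.ρI * P.ρA - P.ρI0 ^ 2 ≠ 0 := by rwa [mul_comm]
  rw [vDot_apply, φDot_apply]
  match_scalars <;> field_simp
  ring

theorem six_eq (x : State) : P.ρA • P.wDot x = x 6 := by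
  have := P.ρA_pos.ne'
  rw [wDot_apply]
  match_scalars
  field_simp

theorem seven_eq (x : State) :
    (P.eps * P.Ap) • P.ΦDot x + P.gam • (P.Ap • x 0 - P.I0 • x 1) = x 7 := by
  have := P.Ap_pos.ne'
  have := P.eps_pos.ne'
  rw [ΦDot_apply]
  match_scalars <;> field_simp <;> ring

theorem ofPhysical_self (x : State) : P.ofPhysical (P.vDot x) (P.φDot x) (P.wDot x) (P.ΦDot x)
    (x 0) (x 1) (x 2) (x 3) = x := by
  ext1 i
  fin_cases i
  · rfl
  · rfl
  · rfl
  · rfl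
  · exact P.four_eq x
  · exact P.five_eq x
  · exact P.six_eq x
  · exact P.seven_eq x

/-! ### Coordinates that turn the energy into the standard norm -/

/-- The components of `energyCoord`. -/
def energyCoordComp : Fin 8 → State →ₗ[ℝ] L2I :=
  ![√P.ρA • (P.vDot - (P.ρI0 / P.ρA) • P.φDot),
    √((P.ρA * P.ρI - P.ρI0 ^ 2) / P.ρA) • P.φDot, √P.ρA • P.wDot,
    √(P.eps * P.Ap) • P.ΦDot, √P.CA • (comp 0 - (P.CI0 / P.CA) • comp 1),
    √((P.CA * P.CI - P.CI0 ^ 2) / P.CA) • comp 1, √(1 / 2 * P.GA) • comp 2,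
    √(1 / P.mu * P.Ap) • comp 3]

/-- Coordinates in which the energy inner product is the standard inner product. -/
def energyCoord (x : State) : State := WithLp.toLp 2 fun i => P.energyCoordComp i x

theorem energyCoord_apply (x : State) : P.energyCoord x =
    WithLp.toLp 2 ![√P.ρA • (P.vDot x - (P.ρI0 / P.ρA) • P.φDot x),
      √((P.ρA * P.ρI - P.ρI0 ^ 2) / P.ρA) • P.φDot x, √P.ρA • P.wDot x,
      √(P.eps * P.Ap) • P.ΦDot x, √P.CA • (x 0 - (P.CI0 / P.CA) • x 1),
      √((P.CA * P.CI - P.CI0 ^ 2) / P.CA) • x 1, √(1 / 2 * P.GA) • x 2,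
      √(1 / P.mu * P.Ap) • x 3] := by
  ext1 i
  fin_cases i <;> rfl

/-- The inverse of `energyCoord`. -/
def ofEnergyCoord (q : State) : State :=
  P.ofPhysical
    ((√P.ρA)⁻¹ • q 0 + (P.ρI0 / P.ρA) • (√((P.ρA * P.ρI - P.ρI0 ^ 2) / P.ρA))⁻¹ • q 1)
    ((√((P.ρA * P.ρI - P.ρI0 ^ 2) / P.ρA))⁻¹ • q 1) ((√P.ρA)⁻¹ • q 2)
    ((√(P.eps * P.Ap))⁻¹ • q 3)
    ((√P.CA)⁻¹ • q 4 + (P.CI0 / P.CA) • (√((P.CA * P.CI - P.CI0 ^ 2) / P.CA))⁻¹ • q 5)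
    ((√((P.CA * P.CI - P.CI0 ^ 2) / P.CA))⁻¹ • q 5) ((√(1 / 2 * P.GA))⁻¹ • q 6)
    ((√(1 / P.mu * P.Ap))⁻¹ • q 7)

theorem weights_pos : 0 < √P.ρA ∧ 0 < √((P.ρA * P.ρI - P.ρI0 ^ 2) / P.ρA) ∧
    0 < √(P.eps * P.Ap) ∧ 0 < √P.CA ∧ 0 < √((P.CA * P.CI - P.CI0 ^ 2) / P.CA) ∧
    0 < √(1 / 2 * P.GA) ∧ 0 < √(1 / P.mu * P.Ap) := by
  have := P.ρA_pos
  have := P.CA_pos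
  have := P.GA_pos
  have := P.Ap_pos
  have := P.eps_pos
  have := P.mu_pos
  have := P.ρdet_pos
  have := P.Cdet_pos
  refine ⟨?_, ?_, ?_, ?_, ?_, ?_, ?_⟩ <;> positivity

theorem ofEnergyCoord_energyCoord (x : State) : P.ofEnergyCoord (P.energyCoord x) = x := by
  obtain ⟨h1, h2, h3, h4, h5, h6, h7⟩ := P.weights_pos
  nth_rewrite 2 [← P.ofPhysical_self x]
  rw [energyCoord_apply]
  have e1 := inv_smul_smul₀ h1.ne' (P.vDot x - (P.ρI0 / P.ρA) • P.φDot x)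
  have e2 := inv_smul_smul₀ h2.ne' (P.φDot x)
  have e3 := inv_smul_smul₀ h4.ne' (x 0 - (P.CI0 / P.CA) • x 1)
  have e4 := inv_smul_smul₀ h5.ne' (x 1)
  unfold ofEnergyCoord
  congr 1
  · refine (congrArg₂ (fun r s => r + (P.ρI0 / P.ρA) • s) e1 e2).trans ?_
    abel
  · exact inv_smul_smul₀ h1.ne' _
  · exact inv_smul_smul₀ h3.ne' _
  · refine (congrArg₂ (fun r s => r + (P.CI0 / P.CA) • s) e3 e4).trans ?_
    abel
  · exact inv_smul_smul₀ h6.ne' _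
  · exact inv_smul_smul₀ h7.ne' _

theorem energyCoord_ofEnergyCoord (q : State) : P.energyCoord (P.ofEnergyCoord q) = q := by
  obtain ⟨h1, h2, h3, h4, h5, h6, h7⟩ := P.weights_pos
  rw [energyCoord_apply]
  unfold ofEnergyCoord
  rw [vDot_ofPhysical, φDot_ofPhysical, wDot_ofPhysical, ΦDot_ofPhysical, add_sub_cancel_right]
  ext1 i
  fin_cases i
  · exact smul_inv_smul₀ h1.ne' _
  · exact smul_inv_smul₀ h2.ne' _
  · exact smul_inv_smul₀ h1.ne' _
  · exact smul_inv_smul₀ h3.ne' _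
  · refine (congrArg (√P.CA • ·) (add_sub_cancel_right ((√P.CA)⁻¹ • q 4) _)).trans ?_
    exact smul_inv_smul₀ h4.ne' _
  · exact smul_inv_smul₀ h5.ne' _
  · exact smul_inv_smul₀ h6.ne' _
  · exact smul_inv_smul₀ h7.ne' _

theorem continuous_comp (i : Fin 8) : Continuous (comp i) :=
  (PiLp.proj (𝕜 := ℝ) 2 (fun _ : Fin 8 => L2I) i).continuous

theorem continuous_vDot : Continuous P.vDot :=
  ((continuous_comp 4).const_smul _).add ((continuous_comp 5).const_smul _)

theorem continuous_φDot : Continuous P.φDot :=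
  ((continuous_comp 4).const_smul _).add ((continuous_comp 5).const_smul _)

theorem continuous_wDot : Continuous P.wDot := (continuous_comp 6).const_smul _

theorem continuous_ΦDot : Continuous P.ΦDot :=
  (((continuous_comp 7).const_smul _).sub ((continuous_comp 0).const_smul _)).add
    ((continuous_comp 1).const_smul _)

/-- The isomorphism from the energy space onto the standard Hilbert space `L²(0,1)⁸`. -/
def energyEquiv : State ≃L[ℝ] State :=
  LinearEquiv.toContinuousLinearEquivOfContinuous
    { toFun := P.energyCoord
      invFun := P.ofEnergyCoord
      left_inv := P.ofEnergyCoord_energyCoord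
      right_inv := P.energyCoord_ofEnergyCoord
      map_add' := fun x y => PiLp.ext fun i => (P.energyCoordComp i).map_add x y
      map_smul' := fun r x => PiLp.ext fun i => (P.energyCoordComp i).map_smul r x } (by
    refine (PiLp.continuous_toLp 2 _).comp (continuous_pi fun i => ?_)
    fin_cases i
    · exact (P.continuous_vDot.sub (P.continuous_φDot.const_smul (P.ρI0 / P.ρA))).const_smul (√P.ρA)
    · exact P.continuous_φDot.const_smul (√((P.ρA * P.ρI - P.ρI0 ^ 2) / P.ρA))
    · exact P.continuous_wDot.const_smul (√P.ρA)
    · exact P.continuous_ΦDot.const_smul (√(P.eps * P.Ap))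
    · exact ((continuous_comp 0).sub ((continuous_comp 1).const_smul (P.CI0 / P.CA))).const_smul
        (√P.CA)
    · exact (continuous_comp 1).const_smul (√((P.CA * P.CI - P.CI0 ^ 2) / P.CA))
    · exact (continuous_comp 2).const_smul (√(1 / 2 * P.GA))
    · exact (continuous_comp 3).const_smul (√(1 / P.mu * P.Ap)))

/-- Completing the square, `ρA v̇² + ρI φ̇² - 2 ρI0 v̇ φ̇ = ρA (v̇ - (ρI0/ρA) φ̇)² + ((ρA ρI -
ρI0²)/ρA) φ̇²`, and likewise for the strains. -/
theorem inner_energyEquiv (x y : State) :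
    inner ℝ (P.energyEquiv x) (P.energyEquiv y) = P.energyInner x y := by
  change inner ℝ (P.energyCoord x) (P.energyCoord y) = _
  have h1 := P.ρA_pos
  have h2 := P.CA_pos
  have h3 := P.GA_pos
  have h4 := P.Ap_pos
  have h5 := P.eps_pos
  have h6 := P.mu_pos
  have h7 := P.ρdet_pos
  have h8 := P.Cdet_pos
  have hs : ∀ {r : ℝ} (_ : 0 ≤ r) (u v : L2I),
      inner ℝ (√r • u) (√r • v) = r * inner ℝ u v := fun hr u v => by
    rw [real_inner_smul_left, real_inner_smul_right, ← mul_assoc, Real.mul_self_sqrt hr]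
  rw [energyCoord_apply, energyCoord_apply, PiLp.inner_apply, Fin.sum_univ_eight]
  change inner ℝ (√_ • _) (√_ • _) + inner ℝ (√_ • _) (√_ • _) + inner ℝ (√_ • _) (√_ • _)
    + inner ℝ (√_ • _) (√_ • _) + inner ℝ (√_ • _) (√_ • _) + inner ℝ (√_ • _) (√_ • _)
    + inner ℝ (√_ • _) (√_ • _) + inner ℝ (√_ • _) (√_ • _) = _
  rw [hs h1.le, hs (by positivity), hs h1.le, hs (by positivity), hs h2.le, hs (by positivity),
    hs (by positivity), hs (by positivity)]
  simp only [inner_sub_left, inner_sub_right, real_inner_smul_left, real_inner_smul_right]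
  unfold energyInner
  field_simp
  ring

theorem energyNorm_eq (x : State) : P.energyNorm x = ‖P.energyEquiv x‖ := by
  rw [energyNorm, ← inner_energyEquiv, norm_eq_sqrt_real_inner]

theorem energy_eq (x : State) : P.energy x = 1 / 2 * ‖P.energyEquiv x‖ ^ 2 := by
  rw [energy, ← inner_energyEquiv, real_inner_self_eq_norm_sq]

theorem energyNorm_equiv :
    ∃ c > 0, ∃ C > 0, ∀ x : State, c * ‖x‖ ≤ P.energyNorm x ∧ P.energyNorm x ≤ C * ‖x‖ := by
  refine ⟨(‖(P.energyEquiv.symm : State →L[ℝ] State)‖ + 1)⁻¹, by positivity,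
    ‖(P.energyEquiv : State →L[ℝ] State)‖ + 1, by positivity, fun x => ?_⟩
  rw [energyNorm_eq]
  constructor
  · rw [inv_mul_le_iff₀ (by positivity)]
    have h := (P.energyEquiv.symm : State →L[ℝ] State).le_opNorm (P.energyEquiv x)
    rw [ContinuousLinearEquiv.coe_coe, ContinuousLinearEquiv.symm_apply_apply] at h
    nlinarith [norm_nonneg (P.energyEquiv x)]
  · have h := (P.energyEquiv : State →L[ℝ] State).le_opNorm x
    rw [ContinuousLinearEquiv.coe_coe] at h
    nlinarith [norm_nonneg x]

/-- Pairs velocities with momenta and forces with strains. In this form the energy balance needs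
only termwise integration by parts. -/
theorem energyInner_eq (x y : State) : P.energyInner x y =
    inner ℝ (P.vDot x) (y 4) + inner ℝ (P.φDot x) (y 5) + inner ℝ (P.wDot x) (y 6)
      + inner ℝ (P.ΦDot x) (y 7) + inner ℝ (P.axialForce x) (y 0)
      + inner ℝ (P.bendingMoment x) (y 1) + 1 / 2 * P.GA * inner ℝ (x 2) (y 2)
      + 1 / P.mu * P.Ap * inner ℝ (x 3) (y 3) := by
  rw [← P.four_eq y, ← P.five_eq y, ← P.six_eq y, ← P.seven_eq y, axialForce_apply,
    bendingMoment_apply]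
  simp only [inner_sub_left, inner_sub_right, inner_add_left, inner_add_right,
    real_inner_smul_left, real_inner_smul_right]
  unfold energyInner
  ring

/-- In each velocity–force pair one factor vanishes at either end, so no boundary term survives. The
two `⟨θ, φ̇⟩` terms cancel, and only the feedback remains. -/
theorem energyInner_rhs (κ : ℝ) {x : State} (hx : x ∈ P.domain) :
    P.energyInner x (P.rhs κ x) = -κ * ‖P.ΦDot x‖ ^ 2 := by
  obtain ⟨hm, b1, b2, b3, b4, b5, b6, b7, b8⟩ := hx
  have i1 := inner_D_add_inner_D (P.vDot_mem hm) (P.axialForce_mem hm)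
  have i2 := inner_D_add_inner_D (P.φDot_mem hm) (P.bendingMoment_mem hm)
  have i3 := inner_D_add_inner_D (P.wDot_mem hm) (hm 2)
  have i4 := inner_D_add_inner_D (P.ΦDot_mem hm) (hm 3)
  rw [b1, b5, mul_zero, zero_mul, sub_zero, real_inner_comm] at i1
  rw [b2, b6, mul_zero, zero_mul, sub_zero, real_inner_comm] at i2
  rw [b3, b7, mul_zero, zero_mul, sub_zero, real_inner_comm] at i3
  rw [b4, b8, mul_zero, zero_mul, sub_zero, real_inner_comm] at i4
  have hcur : (P.h₂ - P.h₁) • P.current κ x = κ • P.ΦDot x := by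
    change (P.h₂ - P.h₁) • (κ / (P.h₂ - P.h₁)) • P.ΦDot x = _
    rw [smul_smul, mul_div_cancel₀ _ (sub_pos.2 P.h₁_lt_h₂).ne']
  rw [energyInner_eq]
  change inner ℝ (P.vDot x) (D (P.axialForce x))
    + inner ℝ (P.φDot x) (D (P.bendingMoment x) + (1 / 2 * P.GA) • x 2)
    + inner ℝ (P.wDot x) ((1 / 2 * P.GA) • D (x 2))
    + inner ℝ (P.ΦDot x) ((1 / P.mu * P.Ap) • D (x 3) - (P.h₂ - P.h₁) • P.current κ x)
    + inner ℝ (P.axialForce x) (D (P.vDot x)) + inner ℝ (P.bendingMoment x) (D (P.φDot x))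
    + 1 / 2 * P.GA * inner ℝ (x 2) (D (P.wDot x) - P.φDot x)
    + 1 / P.mu * P.Ap * inner ℝ (x 3) (D (P.ΦDot x)) = _
  rw [hcur]
  simp only [inner_sub_right, inner_add_right, real_inner_smul_right, real_inner_self_eq_norm_sq]
  rw [real_inner_comm (P.φDot x) (x 2)]
  linear_combination i1 + i2 + 1 / 2 * P.GA * i3 + 1 / P.mu * P.Ap * i4

end Composite

/-! ### The explicit compact inverse of the closed-loop operator -/

namespace Composite

variable (P : Composite)

/-- The `i`-th component of a state as a bounded operator. -/
def proj (i : Fin 8) : State →L[ℝ] L2I := PiLp.proj 2 (fun _ : Fin 8 => L2I) i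

/-! The velocities, the strains `θ`, `Φ'`, and the forces of the solution `x` of `𝒜₂ x = y`, as
functions of `y`. -/

def invV : State →L[ℝ] L2I := V.comp (proj 0)
def invφ : State →L[ℝ] L2I := V.comp (proj 1)
def invW : State →L[ℝ] L2I := V.comp (proj 2 + invφ)
def invΦ : State →L[ℝ] L2I := V.comp (proj 3)
def invθ : State →L[ℝ] L2I := (2 / P.GA) • V₁.comp (proj 6)
-- The system is triangular: `Φ̇` is already known from the fourth equation, so the damping enters
-- the eighth as a mere source term.
def invE (κ : ℝ) : State →L[ℝ] L2I := (P.mu / P.Ap) • V₁.comp (proj 7 + κ • invΦ)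
def invAxial : State →L[ℝ] L2I := V₁.comp (proj 4)
def invBending : State →L[ℝ] L2I := V₁.comp (proj 5 - (1 / 2 * P.GA) • P.invθ)

/-- The strain `v'` of the solution of `𝒜₂ x = y`. -/
def inv0 : State →L[ℝ] L2I :=
  (P.CI / (P.CA * P.CI - P.CI0 ^ 2)) • (invAxial + (P.gam * P.Ap) • invΦ)
    + (P.CI0 / (P.CA * P.CI - P.CI0 ^ 2)) • (P.invBending - (P.gam * P.I0) • invΦ)

/-- The strain `φ'` of the solution of `𝒜₂ x = y`. -/
def inv1 : State →L[ℝ] L2I :=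
  (P.CI0 / (P.CA * P.CI - P.CI0 ^ 2)) • (invAxial + (P.gam * P.Ap) • invΦ)
    + (P.CA / (P.CA * P.CI - P.CI0 ^ 2)) • (P.invBending - (P.gam * P.I0) • invΦ)

/-- The components of `invOp`. -/
def invComp (κ : ℝ) : Fin 8 → State →L[ℝ] L2I :=
  ![P.inv0, P.inv1, P.invθ, P.invE κ, P.ρA • invV - P.ρI0 • invφ, P.ρI • invφ - P.ρI0 • invV,
    P.ρA • invW, (P.eps * P.Ap) • invΦ + P.gam • (P.Ap • P.inv0 - P.I0 • P.inv1)]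

/-- The inverse of the closed-loop operator. -/
def invOp (κ : ℝ) : State →L[ℝ] State :=
  ((PiLp.continuousLinearEquiv 2 ℝ fun _ : Fin 8 => L2I).symm :
    (Fin 8 → L2I) →L[ℝ] State).comp (ContinuousLinearMap.pi (P.invComp κ))

theorem invOp_apply (κ : ℝ) (y : State) : P.invOp κ y = P.ofPhysical (invV y) (invφ y) (invW y)
    (invΦ y) (P.inv0 y) (P.inv1 y) (P.invθ y) (P.invE κ y) := by
  ext1 i
  fin_cases i <;> rfl

/-- Every component is a combination of terms containing `V` or `V₁` as a factor. -/
theorem isCompactOperator_invOp (κ : ℝ) : IsCompactOperator (P.invOp κ) := by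
  have hV : IsCompactOperator invV := isCompactOperator_V.comp_clm (proj 0)
  have hφ : IsCompactOperator invφ := isCompactOperator_V.comp_clm (proj 1)
  have hW : IsCompactOperator invW := isCompactOperator_V.comp_clm (proj 2 + invφ)
  have hΦ : IsCompactOperator invΦ := isCompactOperator_V.comp_clm (proj 3)
  have hθ : IsCompactOperator P.invθ := (isCompactOperator_V₁.comp_clm (proj 6)).smul (2 / P.GA)
  have hE : IsCompactOperator (P.invE κ) :=
    (isCompactOperator_V₁.comp_clm (proj 7 + κ • invΦ)).smul (P.mu / P.Ap)
  have hN : IsCompactOperator invAxial := isCompactOperator_V₁.comp_clm (proj 4)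
  have hM : IsCompactOperator P.invBending :=
    isCompactOperator_V₁.comp_clm (proj 5 - (1 / 2 * P.GA) • P.invθ)
  have h0 : IsCompactOperator P.inv0 :=
    ((hN.add (hΦ.smul (P.gam * P.Ap))).smul (P.CI / (P.CA * P.CI - P.CI0 ^ 2))).add
      ((hM.sub (hΦ.smul (P.gam * P.I0))).smul (P.CI0 / (P.CA * P.CI - P.CI0 ^ 2)))
  have h1 : IsCompactOperator P.inv1 :=
    ((hN.add (hΦ.smul (P.gam * P.Ap))).smul (P.CI0 / (P.CA * P.CI - P.CI0 ^ 2))).add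
      ((hM.sub (hΦ.smul (P.gam * P.I0))).smul (P.CA / (P.CA * P.CI - P.CI0 ^ 2)))
  have h : ∀ i, IsCompactOperator (P.invComp κ i) := by
    intro i
    fin_cases i
    · exact h0
    · exact h1
    · exact hθ
    · exact hE
    · exact (hV.smul P.ρA).sub (hφ.smul P.ρI0)
    · exact (hφ.smul P.ρI).sub (hV.smul P.ρI0)
    · exact hW.smul P.ρA
    · exact (hΦ.smul (P.eps * P.Ap)).add (((h0.smul P.Ap).sub (h1.smul P.I0)).smul P.gam)
  exact (isCompactOperator_pi h).continuous_comp (PiLp.continuous_toLp 2 _)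

section Apply

variable (κ : ℝ) (y : State)

theorem vDot_invOp : P.vDot (P.invOp κ y) = V (y 0) := by
  rw [invOp_apply, vDot_ofPhysical]
  rfl

theorem φDot_invOp : P.φDot (P.invOp κ y) = V (y 1) := by
  rw [invOp_apply, φDot_ofPhysical]
  rfl

theorem wDot_invOp : P.wDot (P.invOp κ y) = V (y 2 + V (y 1)) := by
  rw [invOp_apply, wDot_ofPhysical]
  rfl

theorem ΦDot_invOp : P.ΦDot (P.invOp κ y) = V (y 3) := by
  rw [invOp_apply, ΦDot_ofPhysical]
  rfl

theorem invOp_two : P.invOp κ y 2 = (2 / P.GA) • V₁ (y 6) := rfl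

theorem invOp_three : P.invOp κ y 3 = (P.mu / P.Ap) • V₁ (y 7 + κ • V (y 3)) := rfl

theorem axialForce_invOp : P.axialForce (P.invOp κ y) = V₁ (y 4) := by
  have := P.Cdet_pos.ne'
  have : P.CI * P.CA - P.CI0 ^ 2 ≠ 0 := by rwa [mul_comm]
  rw [axialForce_apply, ΦDot_invOp]
  change P.CA • P.inv0 y - P.CI0 • P.inv1 y - (P.gam * P.Ap) • invΦ y = invAxial y
  simp only [inv0, inv1, add_apply, smul_apply, sub_apply]
  match_scalars <;> field_simp <;> ring

theorem bendingMoment_invOp :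
    P.bendingMoment (P.invOp κ y) = V₁ (y 5 - (1 / 2 * P.GA) • P.invOp κ y 2) := by
  have := P.Cdet_pos.ne'
  have : P.CI * P.CA - P.CI0 ^ 2 ≠ 0 := by rwa [mul_comm]
  rw [bendingMoment_apply, ΦDot_invOp]
  change P.CI • P.inv1 y - P.CI0 • P.inv0 y + (P.gam * P.I0) • invΦ y = P.invBending y
  simp only [inv0, inv1, add_apply, smul_apply, sub_apply]
  match_scalars <;> field_simp <;> ring

theorem invOp_mem : P.invOp κ y ∈ P.domain := by
  have hv := V_mem (y 0)
  have hf := V_mem (y 1)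
  have hw := V_mem (y 2 + V (y 1))
  have hΦ := V_mem (y 3)
  have hN := V₁_mem (y 4)
  have hM := V₁_mem (y 5 - (1 / 2 * P.GA) • P.invOp κ y 2)
  have h2 : P.invOp κ y 2 ∈ H1 := H1.smul_mem _ (V₁_mem _)
  have h3 : P.invOp κ y 3 ∈ H1 := H1.smul_mem _ (V₁_mem _)
  have h0 : P.invOp κ y 0 ∈ H1 :=
    H1.add_mem (H1.smul_mem _ (H1.add_mem hN (H1.smul_mem _ hΦ)))
      (H1.smul_mem _ (H1.sub_mem hM (H1.smul_mem _ hΦ)))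
  have h1 : P.invOp κ y 1 ∈ H1 :=
    H1.add_mem (H1.smul_mem _ (H1.add_mem hN (H1.smul_mem _ hΦ)))
      (H1.smul_mem _ (H1.sub_mem hM (H1.smul_mem _ hΦ)))
  refine ⟨fun i => ?_, ?_, ?_, ?_, ?_, ?_, ?_, ?_, ?_⟩
  · fin_cases i
    · exact h0
    · exact h1
    · exact h2
    · exact h3
    · exact H1.sub_mem (H1.smul_mem _ hv) (H1.smul_mem _ hf)
    · exact H1.sub_mem (H1.smul_mem _ hf) (H1.smul_mem _ hv)
    · exact H1.smul_mem _ hw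
    · exact H1.add_mem (H1.smul_mem _ hΦ)
        (H1.smul_mem _ (H1.sub_mem (H1.smul_mem _ h0) (H1.smul_mem _ h1)))
  · rw [vDot_invOp, bv_zero_V]
  · rw [φDot_invOp, bv_zero_V]
  · rw [wDot_invOp, bv_zero_V]
  · rw [ΦDot_invOp, bv_zero_V]
  · rw [axialForce_invOp, bv_one_V₁]
  · rw [bendingMoment_invOp, bv_one_V₁]
  · rw [invOp_two, bv_smul (V₁_mem _) _ one_mem_I, bv_one_V₁, mul_zero]
  · rw [invOp_three, bv_smul (V₁_mem _) _ one_mem_I, bv_one_V₁, mul_zero]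

end Apply

theorem rhs_seven (κ : ℝ) (x : State) :
    P.rhs κ x 7 = (1 / P.mu * P.Ap) • D (x 3) - κ • P.ΦDot x := by
  change _ - (P.h₂ - P.h₁) • (κ / (P.h₂ - P.h₁)) • P.ΦDot x = _
  rw [smul_smul, mul_div_cancel₀ _ (sub_pos.2 P.h₁_lt_h₂).ne']

theorem rhs_invOp (κ : ℝ) (y : State) : P.rhs κ (P.invOp κ y) = y := by
  have hG := P.GA_pos.ne'
  have hμ := P.mu_pos.ne'
  have hA := P.Ap_pos.ne'
  ext1 i
  fin_cases i
  · change D (P.vDot (P.invOp κ y)) = y 0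
    rw [vDot_invOp, D_V]
  · change D (P.φDot (P.invOp κ y)) = y 1
    rw [φDot_invOp, D_V]
  · change D (P.wDot (P.invOp κ y)) - P.φDot (P.invOp κ y) = y 2
    rw [wDot_invOp, φDot_invOp, D_V, add_sub_cancel_right]
  · change D (P.ΦDot (P.invOp κ y)) = y 3
    rw [ΦDot_invOp, D_V]
  · change D (P.axialForce (P.invOp κ y)) = y 4
    rw [axialForce_invOp, D_V₁]
  · change D (P.bendingMoment (P.invOp κ y)) + (1 / 2 * P.GA) • P.invOp κ y 2 = y 5
    rw [bendingMoment_invOp, D_V₁, sub_add_cancel]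
  · change (1 / 2 * P.GA) • D (P.invOp κ y 2) = y 6
    rw [invOp_two, D_smul (V₁_mem _), D_V₁]
    match_scalars
    field_simp
  · refine (P.rhs_seven κ _).trans ?_
    change _ = y 7
    rw [invOp_three, ΦDot_invOp, D_smul (V₁_mem _), D_V₁]
    match_scalars <;> field_simp
    ring

theorem invOp_rhs (κ : ℝ) {x : State} (hx : x ∈ P.domain) : P.invOp κ (P.rhs κ x) = x := by
  obtain ⟨hm, b1, b2, b3, b4, b5, b6, b7, b8⟩ := hx
  have hG := P.GA_pos.ne'
  have hμ := P.mu_pos.ne'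
  have hA := P.Ap_pos.ne'
  have hd := P.Cdet_pos.ne'
  have hd' : P.CI * P.CA - P.CI0 ^ 2 ≠ 0 := by rwa [mul_comm]
  have ev : invV (P.rhs κ x) = P.vDot x := V_D (P.vDot_mem hm) b1
  have ef : invφ (P.rhs κ x) = P.φDot x := V_D (P.φDot_mem hm) b2
  have ew : invW (P.rhs κ x) = P.wDot x := by
    change V (D (P.wDot x) - P.φDot x + invφ (P.rhs κ x)) = _
    rw [ef, sub_add_cancel, V_D (P.wDot_mem hm) b3]
  have eΦ : invΦ (P.rhs κ x) = P.ΦDot x := V_D (P.ΦDot_mem hm) b4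
  have eN : invAxial (P.rhs κ x) = P.axialForce x := V₁_D (P.axialForce_mem hm) b5
  have eθ : P.invθ (P.rhs κ x) = x 2 := by
    change (2 / P.GA) • V₁ ((1 / 2 * P.GA) • D (x 2)) = x 2
    rw [map_smul, V₁_D (hm 2) b7]
    match_scalars
    field_simp
  have eM : P.invBending (P.rhs κ x) = P.bendingMoment x := by
    change V₁ (D (P.bendingMoment x) + (1 / 2 * P.GA) • x 2
      - (1 / 2 * P.GA) • P.invθ (P.rhs κ x)) = _
    rw [eθ, add_sub_cancel_right, V₁_D (P.bendingMoment_mem hm) b6]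
  have eE : P.invE κ (P.rhs κ x) = x 3 := by
    change (P.mu / P.Ap) • V₁ (P.rhs κ x 7 + κ • invΦ (P.rhs κ x)) = x 3
    rw [rhs_seven, eΦ, sub_add_cancel, map_smul, V₁_D (hm 3) b8]
    match_scalars
    field_simp
  have e0 : P.inv0 (P.rhs κ x) = x 0 := by
    simp only [inv0, add_apply, smul_apply, sub_apply]
    rw [eN, eM, eΦ, axialForce_apply, bendingMoment_apply]
    match_scalars <;> field_simp <;> ring
  have e1 : P.inv1 (P.rhs κ x) = x 1 := by
    simp only [inv1, add_apply, smul_apply, sub_apply]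
    rw [eN, eM, eΦ, axialForce_apply, bendingMoment_apply]
    match_scalars <;> field_simp <;> ring
  rw [invOp_apply, ev, ef, ew, eΦ, e0, e1, eθ, eE, ofPhysical_self]

theorem mem_graph_closedLoop (κ : ℝ) (x y : State) :
    (x, y) ∈ (P.closedLoop κ).graph ↔ x = P.invOp κ y := by
  rw [LinearPMap.mem_graph_iff]
  constructor
  · rintro ⟨⟨z, hz⟩, hzx, hzy⟩
    have hzx' : z = x := hzx
    have hzy' : P.rhs κ z = y := hzy
    rw [← hzy', ← hzx', P.invOp_rhs κ hz]
  · rintro rfl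
    exact ⟨⟨P.invOp κ y, P.invOp_mem κ y⟩, rfl, P.rhs_invOp κ y⟩

theorem invOp_injective (κ : ℝ) : Function.Injective (P.invOp κ) :=
  Function.LeftInverse.injective (P.rhs_invOp κ)

theorem energyInner_invOp (κ : ℝ) (y : State) :
    P.energyInner (P.invOp κ y) y = -κ * ‖P.ΦDot (P.invOp κ y)‖ ^ 2 := by
  have h := P.energyInner_rhs κ (P.invOp_mem κ y)
  rwa [rhs_invOp] at h

end Composite

theorem D_zero : D 0 = 0 := by simpa using D_smul H1.zero_mem 0

namespace Composite

variable (P : Composite)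

/-! ### Unobservable states -/

/-- This coefficient remains when the wave equation of the substrate is eliminated from the moment
equation. It vanishes exactly when both layers have the same wave speed. -/
theorem bendingDefect_eq : (P.ρI - P.ρI0 * P.mid) - (P.CI - P.CI0 * P.mid) * (P.ρs / P.Cs)
    = P.Jp * (P.ρp - P.Cp * (P.ρs / P.Cs)) := by
  have := P.Cs_pos.ne'
  rw [ρI, ρI0, CI, CI0, Ip_eq, I0_eq]
  field_simp
  ring

/-- A set of states which is invariant under the inverse of the closed-loop operator and whose
images under it have vanishing electric field. -/
structure IsUnobservable (κ : ℝ) (N : Set State) : Prop where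
  map_mem : ∀ {n}, n ∈ N → P.invOp κ n ∈ N
  ΦDot_eq_zero : ∀ {n}, n ∈ N → P.ΦDot (P.invOp κ n) = 0

namespace IsUnobservable

variable {P} {κ : ℝ} {N : Set State} {n : State}

/-- Since `rhs κ (invOp κ u) = u`, the state `u` plays the role of the time derivative of `invOp κ
u`. Each use of an evolution equation thus costs one application of `invOp`; here it is `Φ̇' =
∂ₜ(Φ')`. -/
theorem three_eq_zero (h : P.IsUnobservable κ N) (hn : n ∈ N) : P.invOp κ n 3 = 0 := by
  have h1 := congrArg (fun x : State => x 3) (P.rhs_invOp κ (P.invOp κ n))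
  change D (P.ΦDot _) = P.invOp κ n 3 at h1
  rw [← h1, h.ΦDot_eq_zero (h.map_mem hn), D_zero]

theorem seven_eq_zero (h : P.IsUnobservable κ N) (hn : n ∈ N) : P.invOp κ n 7 = 0 := by
  have h1 := congrArg (fun x : State => x 7) (P.rhs_invOp κ (P.invOp κ n))
  change P.rhs κ _ 7 = P.invOp κ n 7 at h1
  rw [← h1, rhs_seven, h.ΦDot_eq_zero (h.map_mem hn), h.three_eq_zero (h.map_mem hn), smul_zero,
    sub_zero, D_zero, smul_zero]

/-- With `Φ̇` and the eighth state zero, `γ (A^p v' - I₀ φ') = 0`; here the coupling `γ ≠ 0` is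
essential. -/
theorem zero_eq (h : P.IsUnobservable κ N) (hn : n ∈ N) :
    P.invOp κ n 0 = P.mid • P.invOp κ n 1 := by
  have h1 := P.seven_eq (P.invOp κ n)
  rw [h.ΦDot_eq_zero hn, h.seven_eq_zero hn, smul_zero, zero_add, I0_eq] at h1
  have h2 := (smul_eq_zero.1 h1).resolve_left P.gam_ne_zero
  have h3 : P.Ap • (P.invOp κ n 0 - P.mid • P.invOp κ n 1) = 0 := by
    rw [← h2]
    module
  exact sub_eq_zero.1 ((smul_eq_zero.1 h3).resolve_left P.Ap_pos.ne')

theorem vDot_eq (h : P.IsUnobservable κ N) (hn : n ∈ N) :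
    P.vDot (P.invOp κ (P.invOp κ n)) = P.mid • P.φDot (P.invOp κ (P.invOp κ n)) := by
  rw [vDot_invOp, φDot_invOp, h.zero_eq hn, map_smul]

theorem axialForce_eq (h : P.IsUnobservable κ N) (hn : n ∈ N) :
    P.axialForce (P.invOp κ n) = (P.Cs * P.As * P.mid) • P.invOp κ n 1 := by
  rw [axialForce_apply, h.ΦDot_eq_zero hn, h.zero_eq hn, CA, CI0, I0_eq]
  module

theorem bendingMoment_eq (h : P.IsUnobservable κ N) (hn : n ∈ N) :
    P.bendingMoment (P.invOp κ n) = (P.CI - P.CI0 * P.mid) • P.invOp κ n 1 := by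
  rw [bendingMoment_apply, h.ΦDot_eq_zero hn, h.zero_eq hn]
  module

theorem bv_one_one (h : P.IsUnobservable κ N) (hn : n ∈ N) : bv 1 (P.invOp κ n 1) = 0 := by
  have hd := P.invOp_mem κ n
  have h1 : bv 1 (P.axialForce (P.invOp κ n)) = 0 := hd.2.2.2.2.2.1
  rw [h.axialForce_eq hn, bv_smul (hd.1 1) _ one_mem_I] at h1
  have := P.Cs_pos
  have := P.As_pos
  have := P.mid_pos
  exact (mul_eq_zero.1 h1).resolve_left (by positivity)

/-- The axial equation with `v = mid · φ`: the piezoelectric contributions cancel, leaving the wave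
equation `Cs φ'' = ρs φ̈` of the substrate. -/
theorem D_one_eq (h : P.IsUnobservable κ N) (hn : n ∈ N) :
    D (P.invOp κ (P.invOp κ (P.invOp κ n)) 1)
      = (P.ρs / P.Cs) • P.φDot (P.invOp κ (P.invOp κ n)) := by
  have h1 := congrArg (fun x : State => x 4) (P.rhs_invOp κ (P.invOp κ (P.invOp κ n)))
  change D (P.axialForce _) = P.invOp κ (P.invOp κ n) 4 at h1
  rw [h.axialForce_eq (h.map_mem (h.map_mem hn)), D_smul ((P.invOp_mem κ _).1 1), ← P.four_eq,
    h.vDot_eq hn, ρA, ρI0, I0_eq] at h1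
  have := P.Cs_pos.ne'
  have := P.As_pos.ne'
  have := P.mid_pos.ne'
  have h2 := congrArg ((P.Cs * P.As * P.mid)⁻¹ • ·) h1
  simp only [inv_smul_smul₀ (show P.Cs * P.As * P.mid ≠ 0 by positivity)] at h2
  rw [h2]
  match_scalars
  field_simp
  ring

/-- The moment equation with `φ''` eliminated by the wave equation. -/
theorem two_eq (h : P.IsUnobservable κ N) (hn : n ∈ N) :
    (1 / 2 * P.GA) • P.invOp κ (P.invOp κ (P.invOp κ n)) 2
      = (P.Jp * (P.ρp - P.Cp * (P.ρs / P.Cs))) • P.φDot (P.invOp κ (P.invOp κ n)) := by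
  have h1 := congrArg (fun x : State => x 5) (P.rhs_invOp κ (P.invOp κ (P.invOp κ n)))
  change D (P.bendingMoment _) + (1 / 2 * P.GA) • _ = P.invOp κ (P.invOp κ n) 5 at h1
  rw [h.bendingMoment_eq (h.map_mem (h.map_mem hn)), D_smul ((P.invOp_mem κ _).1 1), ← P.five_eq,
    h.vDot_eq hn, h.D_one_eq hn] at h1
  rw [eq_sub_of_add_eq' h1, ← P.bendingDefect_eq]
  module

theorem D_φDot_eq (n : State) : D (P.φDot (P.invOp κ n)) = n 1 := by rw [φDot_invOp, D_V]

/-- If the angular velocity vanishes on all unobservable states (after smoothing), then only `0` is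
unobservable. -/
theorem eq_zero_of_φDot_eq_zero (h : P.IsUnobservable κ N)
    (hφ : ∀ {n}, n ∈ N → P.φDot (P.invOp κ (P.invOp κ (P.invOp κ n))) = 0) (hn : n ∈ N) :
    n = 0 := by
  have hone : ∀ {n}, n ∈ N → P.invOp κ (P.invOp κ n) 1 = 0 := fun {n} hn => by
    rw [← D_φDot_eq (κ := κ), hφ hn, D_zero]
  have htwo : ∀ {n}, n ∈ N → P.invOp κ (P.invOp κ (P.invOp κ (P.invOp κ n))) 2 = 0 :=
    fun {n} hn => by
      have h1 := h.two_eq (h.map_mem hn)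
      rw [hφ hn, smul_zero] at h1
      have := P.GA_pos
      exact (smul_eq_zero.1 h1).resolve_left (by positivity)
  -- All eight components of this fourfold preimage vanish, and injectivity of `invOp` brings the
  -- conclusion back to `n`.
  let u := P.invOp κ (P.invOp κ (P.invOp κ (P.invOp κ n)))
  have hm1 := h.map_mem hn
  have hm2 := h.map_mem hm1
  have hm3 := h.map_mem hm2
  have u1 : u 1 = 0 := hone hm2
  have u0 : u 0 = 0 := by rw [show u 0 = _ from h.zero_eq hm3, show P.invOp κ _ 1 = 0 from u1,
    smul_zero]
  have uφ : P.φDot u = 0 := hφ hm1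
  have uv : P.vDot u = 0 := by rw [show P.vDot u = _ from h.vDot_eq hm2,
    show P.φDot (P.invOp κ _) = 0 from uφ, smul_zero]
  have u6 : u 6 = 0 := by
    have h1 := congrArg (fun x : State => x 6) (P.rhs_invOp κ u)
    change (1 / 2 * P.GA) • D (P.invOp κ u 2) = u 6 at h1
    rw [← h1, htwo hm1, D_zero, smul_zero]
  have hu : u = 0 := by
    ext1 i
    fin_cases i
    · exact u0
    · exact u1
    · exact htwo hn
    · exact h.three_eq_zero hm3
    · refine (P.four_eq u).symm.trans ?_
      rw [uφ, uv]
      simp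
    · refine (P.five_eq u).symm.trans ?_
      rw [uφ, uv]
      simp
    · exact u6
    · exact h.seven_eq_zero hm3
  have hinj := P.invOp_injective κ
  have h0 : ∀ {x}, P.invOp κ x = 0 → x = 0 := fun {x} hx => hinj (by rw [hx, map_zero])
  exact h0 (h0 (h0 (h0 hu)))

/-- The case of equal wave speeds in the two layers. -/
theorem φDot_eq_zero_of_eq (h : P.IsUnobservable κ N) (hK : P.ρp - P.Cp * (P.ρs / P.Cs) = 0)
    (hn : n ∈ N) : P.φDot (P.invOp κ (P.invOp κ (P.invOp κ (P.invOp κ n)))) = 0 := by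
  have htwo : ∀ {n}, n ∈ N → P.invOp κ (P.invOp κ (P.invOp κ n)) 2 = 0 := fun {n} hn => by
    have h1 := h.two_eq hn
    rw [hK, mul_zero, zero_smul] at h1
    have := P.GA_pos
    exact (smul_eq_zero.1 h1).resolve_left (by positivity)
  have hw : P.wDot (P.invOp κ (P.invOp κ (P.invOp κ (P.invOp κ n)))) = 0 := by
    have h1 := congrArg (fun x : State => x 6)
      (P.rhs_invOp κ (P.invOp κ (P.invOp κ (P.invOp κ (P.invOp κ n)))))
    change (1 / 2 * P.GA) • D (P.invOp κ _ 2) = P.invOp κ _ 6 at h1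
    rw [htwo (h.map_mem (h.map_mem hn)), D_zero, smul_zero] at h1
    rw [wDot_apply, ← h1, smul_zero]
  have h2 := congrArg (fun x : State => x 2)
    (P.rhs_invOp κ (P.invOp κ (P.invOp κ (P.invOp κ n))))
  change D (P.wDot _) - P.φDot _ = P.invOp κ _ 2 at h2
  rw [hw, D_zero, htwo hn, zero_sub, neg_eq_zero] at h2
  exact h2

/-- The free-end condition `θ = 0` passes to the angular velocity because the coefficient in
`two_eq` is nonzero. This is the surplus boundary condition. -/
theorem bv_one_φDot (h : P.IsUnobservable κ N) (hK : P.ρp - P.Cp * (P.ρs / P.Cs) ≠ 0)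
    (hn : n ∈ N) : bv 1 (P.φDot (P.invOp κ (P.invOp κ n))) = 0 := by
  have h1 := congrArg (bv 1) (h.two_eq hn)
  have hd := P.invOp_mem κ (P.invOp κ (P.invOp κ n))
  have hd' := P.invOp_mem κ (P.invOp κ n)
  have h2 : bv 1 (P.invOp κ (P.invOp κ (P.invOp κ n)) 2) = 0 := hd.2.2.2.2.2.2.2.1
  rw [bv_smul (hd.1 2) _ one_mem_I, bv_smul (P.φDot_mem hd'.1) _ one_mem_I, h2, mul_zero] at h1
  exact (mul_eq_zero.1 h1.symm).resolve_left (mul_ne_zero P.Jp_pos.ne' hK)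

/-- The case of different wave speeds in the two layers: the rotation satisfies a wave equation
with overdetermined conditions at the free end. -/
theorem φDot_eq_zero_of_ne (h : P.IsUnobservable κ N) (hK : P.ρp - P.Cp * (P.ρs / P.Cs) ≠ 0)
    {T : ℝ≥0 → State →L[ℝ] State} (hT : ∀ t, ∀ n ∈ N, T t n ∈ N) (h0 : ∀ x, T 0 x = x)
    (hc : ∀ t x, T t (P.invOp κ x) = P.invOp κ (T t x))
    (hd : ∀ x, ∀ t : ℝ, 0 ≤ t → HasDerivWithinAt (fun s : ℝ => T s.toNNReal (P.invOp κ x))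
      (T t.toNNReal x) (Ici 0) t)
    (hb : ∀ x, ∃ M, ∀ t, ‖T t x‖ ≤ M) (hn : n ∈ N) :
    P.φDot (P.invOp κ (P.invOp κ (P.invOp κ n))) = 0 := by
  set u := P.invOp κ (P.invOp κ n) with hu
  let c := P.ρs / P.Cs
  have hcpos : 0 < c := div_pos P.ρs_pos P.Cs_pos
  let φ : State →L[ℝ] L2I := ⟨P.φDot, P.continuous_φDot⟩
  -- Along the orbit `f` is `φ̇`, `a` is `φ'`, and `f'`, `a'` are their time derivatives; the wave
  -- equation is `D f = a'`, `D a = c f'`.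
  let f : ℝ → L2I := fun t => φ (T t.toNNReal (P.invOp κ u))
  let a : ℝ → L2I := fun t => proj 1 (T t.toNNReal (P.invOp κ u))
  let f' : ℝ → L2I := fun t => φ (T t.toNNReal u)
  let a' : ℝ → L2I := fun t => proj 1 (T t.toNNReal u)
  have hf : ∀ t, 0 ≤ t → HasDerivWithinAt f (f' t) (Ici 0) t := fun t ht =>
    φ.hasFDerivAt.comp_hasDerivWithinAt t (hd u t ht)
  have ha : ∀ t, 0 ≤ t → HasDerivWithinAt a (a' t) (Ici 0) t := fun t ht =>
    (proj 1).hasFDerivAt.comp_hasDerivWithinAt t (hd u t ht)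
  -- The semigroup preserves `N` and commutes with `invOp`, so the identities for unobservable
  -- states hold at every time.
  have horb : ∀ t : ℝ≥0, ∃ k ∈ N, T t u = P.invOp κ (P.invOp κ k) ∧
      T t (P.invOp κ u) = P.invOp κ (P.invOp κ (P.invOp κ k)) := fun t =>
    ⟨T t n, hT t n hn, by rw [hu, hc, hc], by rw [hu, hc, hc, hc]⟩
  have hfm : ∀ t, f t ∈ H1 ∧ a t ∈ H1 ∧ D (f t) = a' t ∧ D (a t) = c • f' t ∧ bv 0 (f t) = 0 ∧
      bv 1 (f t) = 0 ∧ bv 1 (a t) = 0 := by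
    intro t
    obtain ⟨k, hk, e1, e2⟩ := horb t.toNNReal
    have hdom := P.invOp_mem κ (P.invOp κ (P.invOp κ k))
    simp only [f, a, f', a', e1, e2]
    exact ⟨P.φDot_mem hdom.1, hdom.1 1, D_φDot_eq _, h.D_one_eq hk, hdom.2.2.1,
      h.bv_one_φDot hK (h.map_mem hk), h.bv_one_one (h.map_mem (h.map_mem hk))⟩
  have hf'eq : ∀ t, f' t = c⁻¹ • D (a t) := fun t => by
    rw [(hfm t).2.2.2.1, inv_smul_smul₀ hcpos.ne']
  -- Conservation of the wave energy, as `φ̇` vanishes at both ends.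
  have hE : ∀ t, 0 ≤ t → HasDerivWithinAt (fun t => ‖f t‖ ^ 2 + c⁻¹ * ‖a t‖ ^ 2) 0 (Ici 0) t := by
    intro t ht
    have h1 := (hf t ht).norm_sq.add ((ha t ht).norm_sq.const_mul c⁻¹)
    obtain ⟨m1, m2, e1, e2, b1, b2, b3⟩ := hfm t
    have h2 := inner_D_add_inner_D m1 m2
    rw [b1, b2, zero_mul, zero_mul, sub_zero, e1, real_inner_comm] at h2
    have h3 : 2 * inner ℝ (f t) (f' t) + c⁻¹ * (2 * inner ℝ (a t) (a' t)) = 0 := by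
      rw [hf'eq, real_inner_smul_right]
      linear_combination 2 * c⁻¹ * h2
    rw [h3] at h1
    exact h1
  have hconst : ∀ t, 0 ≤ t → ‖f t‖ ^ 2 + c⁻¹ * ‖a t‖ ^ 2 = ‖f 0‖ ^ 2 + c⁻¹ * ‖a 0‖ ^ 2 := by
    intro t ht
    have h1 := eq_add_mul_of_hasDerivWithinAt hE ht
    rwa [mul_zero, add_zero] at h1
  -- The multiplier `z φ'`: as `φ̇` and `φ'` both vanish at `z = 1`, its pairing with `φ̇` decreases
  -- at the constant rate of half the wave energy. Being bounded, it forces that energy to be zero.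
  have hψ : ∀ t, 0 ≤ t → HasDerivWithinAt (fun t => inner ℝ (Z (f t)) (a t))
      (-(‖f 0‖ ^ 2 + c⁻¹ * ‖a 0‖ ^ 2) / 2) (Ici 0) t := by
    intro t ht
    have hZ : HasDerivWithinAt (fun t => Z (f t)) (Z (f' t)) (Ici 0) t :=
      Z.hasFDerivAt.comp_hasDerivWithinAt t (hf t ht)
    have h1 := hZ.inner ℝ (ha t ht)
    obtain ⟨m1, m2, e1, e2, b1, b2, b3⟩ := hfm t
    have h2 : inner ℝ (Z (f t)) (a' t) + inner ℝ (Z (f' t)) (a t)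
        = -(‖f 0‖ ^ 2 + c⁻¹ * ‖a 0‖ ^ 2) / 2 := by
      have i1 := inner_Z_D m1
      have i2 := inner_Z_D m2
      rw [b2] at i1
      rw [b3] at i2
      rw [← hconst t ht, hf'eq, map_smul, real_inner_smul_left, i2, ← e1, inner_Z_comm,
        real_inner_comm, i1]
      ring
    rw [h2] at h1
    exact h1
  obtain ⟨M, hM⟩ := hb (P.invOp κ u)
  have hz : -(‖f 0‖ ^ 2 + c⁻¹ * ‖a 0‖ ^ 2) / 2 = 0 := by
    have hM0 : 0 ≤ M := (norm_nonneg _).trans (hM 0)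
    refine deriv_eq_zero_of_bounded hψ
      (M := ‖Z‖ * (‖φ‖ * M) * (‖proj 1‖ * M)) fun t _ => ?_
    refine (abs_real_inner_le_norm _ _).trans (mul_le_mul ?_ ?_ (norm_nonneg _) (by positivity))
    · refine (Z.le_opNorm _).trans (mul_le_mul_of_nonneg_left ?_ (norm_nonneg _))
      exact (φ.le_opNorm _).trans (mul_le_mul_of_nonneg_left (hM _) (norm_nonneg _))
    · exact ((proj 1).le_opNorm _).trans (mul_le_mul_of_nonneg_left (hM _) (norm_nonneg _))
  have hf0 : ‖f 0‖ ^ 2 = 0 := by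
    have : 0 ≤ c⁻¹ * ‖a 0‖ ^ 2 := by positivity
    linarith [sq_nonneg ‖f 0‖]
  have hf00 : f 0 = 0 := norm_eq_zero.1 (pow_eq_zero_iff two_ne_zero |>.1 hf0)
  simpa [f, φ, h0] using hf00

theorem eq_zero (h : P.IsUnobservable κ N)
    {T : ℝ≥0 → State →L[ℝ] State} (hT : ∀ t, ∀ n ∈ N, T t n ∈ N) (h0 : ∀ x, T 0 x = x)
    (hc : ∀ t x, T t (P.invOp κ x) = P.invOp κ (T t x))
    (hd : ∀ x, ∀ t : ℝ, 0 ≤ t → HasDerivWithinAt (fun s : ℝ => T s.toNNReal (P.invOp κ x))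
      (T t.toNNReal x) (Ici 0) t)
    (hb : ∀ x, ∃ M, ∀ t, ‖T t x‖ ≤ M) (hn : n ∈ N) : n = 0 := by
  by_cases hK : P.ρp - P.Cp * (P.ρs / P.Cs) = 0
  -- For equal speeds `φ̇` is known to vanish only after four applications of `invOp`; passing to
  -- the image of `N` absorbs the extra one.
  · have h' : P.IsUnobservable κ (P.invOp κ '' N) :=
      ⟨by rintro _ ⟨k, hk, rfl⟩; exact ⟨_, h.map_mem hk, rfl⟩,
        by rintro _ ⟨k, hk, rfl⟩; exact h.ΦDot_eq_zero (h.map_mem hk)⟩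
    have h1 := h'.eq_zero_of_φDot_eq_zero (n := P.invOp κ n)
      (by rintro _ ⟨k, hk, rfl⟩; exact h.φDot_eq_zero_of_eq hK hk) ⟨n, hn, rfl⟩
    exact P.invOp_injective κ (by rw [h1, map_zero])
  · exact h.eq_zero_of_φDot_eq_zero (fun hk => h.φDot_eq_zero_of_ne hK hT h0 hc hd hb hk) hn

end IsUnobservable

end Composite

namespace Composite

variable (P : Composite) (κ : ℝ)

/-! ### The closed-loop semigroup -/

/-- The inverse of the closed-loop operator in coordinates of the energy space. -/
def invOpH : State →L[ℝ] State :=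
  (P.energyEquiv : State →L[ℝ] State).comp
    ((P.invOp κ).comp (P.energyEquiv.symm : State →L[ℝ] State))

theorem invOpH_apply (x : State) : P.invOpH κ (P.energyEquiv x) = P.energyEquiv (P.invOp κ x) := by
  simp [invOpH]

theorem inner_invOpH (x : State) : inner ℝ (P.invOpH κ (P.energyEquiv x)) (P.energyEquiv x)
    = -κ * ‖P.ΦDot (P.invOp κ x)‖ ^ 2 := by
  rw [invOpH_apply, inner_energyEquiv, energyInner_invOp]

theorem inner_invOpH_nonpos (hκ : 0 < κ) (q : State) : inner ℝ (P.invOpH κ q) q ≤ 0 := by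
  obtain ⟨x, rfl⟩ := P.energyEquiv.surjective q
  rw [inner_invOpH]
  have : 0 ≤ κ * ‖P.ΦDot (P.invOp κ x)‖ ^ 2 := by positivity
  linarith

theorem invOpH_injective : Function.Injective (P.invOpH κ) :=
  P.energyEquiv.injective.comp ((P.invOp_injective κ).comp P.energyEquiv.symm.injective)

theorem isCompactOperator_invOpH : IsCompactOperator (P.invOpH κ) :=
  ((P.isCompactOperator_invOp κ).comp_clm (P.energyEquiv.symm : State →L[ℝ] State)).clm_comp
    (P.energyEquiv : State →L[ℝ] State)

/-- The transport of a semigroup from the coordinates of the energy space. -/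
def transport (S : ℝ≥0 → State →L[ℝ] State) (t : ℝ≥0) : State →L[ℝ] State :=
  (P.energyEquiv.symm : State →L[ℝ] State).comp
    ((S t).comp (P.energyEquiv : State →L[ℝ] State))

theorem energyEquiv_transport (S : ℝ≥0 → State →L[ℝ] State) (t : ℝ≥0) (x : State) :
    P.energyEquiv (P.transport S t x) = S t (P.energyEquiv x) := by
  simp [transport]

theorem transport_apply (S : ℝ≥0 → State →L[ℝ] State) (t : ℝ≥0) (x : State) :
    P.transport S t x = P.energyEquiv.symm (S t (P.energyEquiv x)) := rfl

variable {P κ} {S : ℝ≥0 → State →L[ℝ] State}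

theorem isC0Semigroup_transport (hS : IsC0Semigroup S) : IsC0Semigroup (P.transport S) where
  map_zero := by
    ext1 x
    rw [transport_apply, hS.map_zero]
    simp
  map_add s t := by
    ext1 x
    rw [transport_apply, hS.map_add, ContinuousLinearMap.comp_apply, ContinuousLinearMap.comp_apply,
      transport_apply, energyEquiv_transport]
  strongly_continuous x :=
    P.energyEquiv.symm.continuous.comp (hS.strongly_continuous (P.energyEquiv x))

theorem isGenerator_transport (hS : IsInverseGenerated (P.invOpH κ) S) :
    IsGenerator (P.closedLoop κ) (P.transport S) := by
  intro x y
  rw [mem_graph_closedLoop, ← P.energyEquiv.injective.eq_iff, ← invOpH_apply,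
    ← hS.tendsto_slope_iff]
  constructor
  · intro h
    have h1 := (P.energyEquiv.symm.continuous.tendsto _).comp h
    rw [ContinuousLinearEquiv.symm_apply_apply] at h1
    refine h1.congr fun t => ?_
    rw [Function.comp_apply, map_smul, map_sub, ContinuousLinearEquiv.symm_apply_apply,
      transport_apply]
  · intro h
    refine ((P.energyEquiv.continuous.tendsto _).comp h).congr fun t => ?_
    rw [Function.comp_apply, map_smul, map_sub, energyEquiv_transport]

theorem energyNorm_transport (S : ℝ≥0 → State →L[ℝ] State) (t : ℝ≥0) (x : State) :
    P.energyNorm (P.transport S t x) = ‖S t (P.energyEquiv x)‖ := by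
  rw [energyNorm_eq, energyEquiv_transport]

theorem transport_invOp (hS : IsInverseGenerated (P.invOpH κ) S) (t : ℝ≥0) (x : State) :
    P.transport S t (P.invOp κ x) = P.invOp κ (P.transport S t x) := by
  apply P.energyEquiv.injective
  rw [energyEquiv_transport, ← invOpH_apply, hS.commute, ← invOpH_apply, energyEquiv_transport]

theorem hasDerivWithinAt_transport (hS : IsInverseGenerated (P.invOpH κ) S) (x : State) {t : ℝ}
    (ht : 0 ≤ t) : HasDerivWithinAt (fun s : ℝ => P.transport S s.toNNReal (P.invOp κ x))
      (P.transport S t.toNNReal x) (Ici 0) t := by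
  have h := (P.energyEquiv.symm : State →L[ℝ] State).hasFDerivAt.comp_hasDerivWithinAt t
    (hS.hasDerivWithinAt (P.energyEquiv x) ht)
  rw [invOpH_apply] at h
  exact h

theorem exists_eq_invOp {x : State} (hx : x ∈ (P.closedLoop κ).domain) :
    ∃ y, x = P.invOp κ y :=
  ⟨P.rhs κ x, (P.invOp_rhs κ hx).symm⟩

theorem isClassicalSolution_transport (hS : IsInverseGenerated (P.invOpH κ) S) (y : State) :
    IsClassicalSolution (P.closedLoop κ) (P.invOp κ y)
      fun t => P.transport S t (P.invOp κ y) := by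
  refine ⟨?_, fun t => ?_⟩
  · change P.transport S 0 _ = _
    rw [(isC0Semigroup_transport hS.isC0).map_zero]
    rfl
  · have e := transport_invOp hS t y
    have hmem : P.transport S t (P.invOp κ y) ∈ (P.closedLoop κ).domain := by
      rw [e]
      exact P.invOp_mem κ _
    refine ⟨hmem, ?_⟩
    have hA : P.closedLoop κ ⟨P.transport S t (P.invOp κ y), hmem⟩ = P.transport S t y := by
      change P.rhs κ (P.transport S t (P.invOp κ y)) = _
      rw [e, rhs_invOp]
    rw [hA]
    have h := hasDerivWithinAt_transport hS y (NNReal.coe_nonneg t)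
    rwa [Real.toNNReal_coe] at h

theorem isClassicalSolution_unique (hκ : 0 < κ) {x₀ : State} {u v : ℝ≥0 → State}
    (hu : IsClassicalSolution (P.closedLoop κ) x₀ u)
    (hv : IsClassicalSolution (P.closedLoop κ) x₀ v) : u = v := by
  choose mu du using hu.2
  choose mv dv using hv.2
  let w : ℝ → State := fun s => P.energyEquiv (u s.toNNReal - v s.toNNReal)
  let w' : ℝ → State := fun s =>
    P.energyEquiv (P.rhs κ (u s.toNNReal) - P.rhs κ (v s.toNNReal))
  have hw : ∀ t, 0 ≤ t → HasDerivWithinAt w (w' t) (Ici 0) t := fun t ht => by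
    have h1 := du t.toNNReal
    have h2 := dv t.toNNReal
    rw [Real.coe_toNNReal _ ht] at h1 h2
    exact (P.energyEquiv : State →L[ℝ] State).hasFDerivAt.comp_hasDerivWithinAt t (h1.sub h2)
  have hi : ∀ t, 0 ≤ t → inner ℝ (w t) (w' t) ≤ 0 := fun t _ => by
    -- The difference of the solutions is `invOp` of its own derivative, so dissipativity of `invOp`
    -- makes its energy norm nonincreasing.
    have e : u t.toNNReal - v t.toNNReal
        = P.invOp κ (P.rhs κ (u t.toNNReal) - P.rhs κ (v t.toNNReal)) := by
      rw [map_sub, P.invOp_rhs κ (mu _), P.invOp_rhs κ (mv _)]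
    simp only [w, w']
    rw [e, ← invOpH_apply]
    exact P.inner_invOpH_nonpos κ hκ _
  have h0 : w 0 = 0 := by simp [w, hu.1, hv.1]
  funext t
  have h := eq_zero_of_dissipative_flow hw hi h0 (NNReal.coe_nonneg t)
  simp only [w, Real.toNNReal_coe] at h
  exact sub_eq_zero.1 (P.energyEquiv.injective (h.trans (map_zero _).symm))

theorem hasDerivWithinAt_energy (hS : IsInverseGenerated (P.invOpH κ) S) {x₀ : State}
    (hx : x₀ ∈ (P.closedLoop κ).domain) (t : ℝ≥0) :
    HasDerivWithinAt (fun s : ℝ => P.energy (P.transport S s.toNNReal x₀))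
      (-∫ z in Ioo (0 : ℝ) 1, κ * (P.ΦDot (P.transport S t x₀) z) ^ 2) (Ici 0) (t : ℝ) := by
  obtain ⟨y, rfl⟩ := exists_eq_invOp hx
  have h := ((P.energyEquiv : State →L[ℝ] State).hasFDerivAt.comp_hasDerivWithinAt (t : ℝ)
    (hasDerivWithinAt_transport hS y (NNReal.coe_nonneg t))).norm_sq.const_mul (1 / 2)
  rw [Real.toNNReal_coe] at h
  have e : (1 / 2 : ℝ) * (2 * inner ℝ (P.energyEquiv (P.transport S t (P.invOp κ y)))
      (P.energyEquiv (P.transport S t y)))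
      = -∫ z in Ioo (0 : ℝ) 1, κ * (P.ΦDot (P.transport S t (P.invOp κ y)) z) ^ 2 := by
    rw [transport_invOp hS, ← invOpH_apply, inner_invOpH, integral_const_mul, ← norm_sq_L2I]
    ring
  simp only [Function.comp_apply, Real.toNNReal_coe, ContinuousLinearEquiv.coe_coe] at h
  rw [e] at h
  exact h.congr_of_eventuallyEq (Eventually.of_forall fun s => P.energy_eq _) (P.energy_eq _)

/-- Norm-preserving orbits satisfy `⟨B y, y⟩ = 0`, which by the energy identity and `κ > 0` means
`Φ̇(B y) = 0`; so they are unobservable. -/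
theorem eq_zero_of_isometric (hκ : 0 < κ) (hS : IsInverseGenerated (P.invOpH κ) S) {q : State}
    (hq : ∀ t, ‖S t q‖ = ‖q‖) : q = 0 := by
  let N : Set State := {x | ∀ t, ‖S t (P.energyEquiv x)‖ = ‖P.energyEquiv x‖}
  have hN : P.IsUnobservable κ N := by
    refine ⟨fun {x} hx t => ?_, fun {x} hx => ?_⟩
    · rw [← invOpH_apply]
      exact (hS.isometric_inverse hx).2 t
    · have h1 := (hS.isometric_inverse hx).1
      rw [inner_invOpH] at h1
      have h2 := (mul_eq_zero.1 h1).resolve_left (neg_ne_zero.2 hκ.ne')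
      exact norm_eq_zero.1 (pow_eq_zero_iff two_ne_zero |>.1 h2)
  have hq' : P.energyEquiv.symm q ∈ N := fun t => by
    rw [ContinuousLinearEquiv.apply_symm_apply]
    exact hq t
  have h := hN.eq_zero (T := P.transport S) (fun t x hx s => by
      rw [energyEquiv_transport]
      exact hS.isometric_map hx t s)
    (fun x => by rw [(isC0Semigroup_transport hS.isC0).map_zero]; rfl)
    (transport_invOp hS) (fun x t ht => hasDerivWithinAt_transport hS x ht)
    (fun x => ⟨‖(P.energyEquiv.symm : State →L[ℝ] State)‖ * ‖P.energyEquiv x‖, fun t =>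
      ((P.energyEquiv.symm : State →L[ℝ] State).le_opNorm _).trans
        (mul_le_mul_of_nonneg_left (hS.norm_le t _) (norm_nonneg _))⟩) hq'
  simpa using h

theorem asymptoticallyStable_transport (hκ : 0 < κ) (hS : IsInverseGenerated (P.invOpH κ) S) :
    P.AsymptoticallyStable (P.transport S) := by
  refine ⟨fun r hr => ⟨r, hr, fun x hx t => ?_⟩, fun x => ?_⟩
  · rw [energyNorm_transport]
    rw [energyNorm_eq] at hx
    exact (hS.norm_le t _).trans_lt hx
  · simp only [energyNorm_transport]
    exact hS.tendsto_norm_zero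
      (denseRange_of_dissipative (P.inner_invOpH_nonpos κ hκ) (P.invOpH_injective κ))
      (P.isCompactOperator_invOpH κ) (fun q hq => eq_zero_of_isometric hκ hS hq) _

end Composite

end PiezoTimoshenko

end

theorem mainTheorem4 (P : PiezoTimoshenko.Composite) (κ : ℝ) (hκ : 0 < κ)
    (hρ : P.ρA * P.ρI ≠ P.ρI0 ^ 2) (hC : P.CA * P.CI ≠ P.CI0 ^ 2) :
    -- `2 ℋ_T` is the square of a norm equivalent to the norm of `L²(0,1)⁸`
    (∃ c > 0, ∃ C > 0, ∀ x : PiezoTimoshenko.State,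
      c * ‖x‖ ≤ P.energyNorm x ∧ P.energyNorm x ≤ C * ‖x‖) ∧
    -- the closed-loop operator generates a strongly continuous semigroup of contractions
    ∃ T : ℝ≥0 → PiezoTimoshenko.State →L[ℝ] PiezoTimoshenko.State,
      PiezoTimoshenko.IsC0Semigroup T ∧
      PiezoTimoshenko.IsGenerator (P.closedLoop κ) T ∧
      (∀ t x, P.energyNorm (T t x) ≤ P.energyNorm x) ∧
      -- classical solutions exist and are unique
      (∀ x₀ ∈ (P.closedLoop κ).domain, ∀ u : ℝ≥0 → PiezoTimoshenko.State,
        PiezoTimoshenko.IsClassicalSolution (P.closedLoop κ) x₀ u ↔ u = fun t => T t x₀) ∧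
      -- the energy is a Lyapunov function
      (∀ x₀ ∈ (P.closedLoop κ).domain, ∀ t : ℝ≥0,
        HasDerivWithinAt (fun s : ℝ => P.energy (T s.toNNReal x₀))
          (-∫ z in Set.Ioo (0 : ℝ) 1, κ * (P.ΦDot (T t x₀) z) ^ 2) (Set.Ici 0) (t : ℝ)) ∧
      -- the closed-loop system is asymptotically stable
      P.AsymptoticallyStable T := by
  obtain ⟨S, hS⟩ := PiezoTimoshenko.exists_isInverseGenerated
    (P.inner_invOpH_nonpos κ hκ) (P.invOpH_injective κ)
  refine ⟨P.energyNorm_equiv, P.transport S,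
    PiezoTimoshenko.Composite.isC0Semigroup_transport hS.isC0,
    PiezoTimoshenko.Composite.isGenerator_transport hS, fun t x => ?_, fun x₀ hx u => ?_,
    fun x₀ hx t => PiezoTimoshenko.Composite.hasDerivWithinAt_energy hS hx t,
    PiezoTimoshenko.Composite.asymptoticallyStable_transport hκ hS⟩
  · rw [PiezoTimoshenko.Composite.energyNorm_transport, P.energyNorm_eq]
    exact hS.norm_le t _
  · obtain ⟨y, rfl⟩ := PiezoTimoshenko.Composite.exists_eq_invOp hx
    have h := PiezoTimoshenko.Composite.isClassicalSolution_transport hS y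
    exact ⟨fun hu => PiezoTimoshenko.Composite.isClassicalSolution_unique hκ hu h,
      fun hu => hu ▸ h⟩
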